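/- Let $k$ be a field, $q$ an indeterminate, $K$ a finite extension of $k(q)$, and $\mathcal O_K$ the integral closure of $k[q]$ in $K$. Let $0\neq P\in\mathcal O_K[x]$ and $$\mathcal A=\mathcal O_K\Big[x,\tfrac1{P(x)},\tfrac1{P(qx)},\tfrac1{P(q^2x)},\dots\Big]\subset K(x),$$ with $\sigma_q f(x)=f(qx)$, $\delta_q f=\frac{\sigma_q f-f}{q-1}$ and $\partial=x\frac{d}{dx}$ (all of which preserve $\mathcal A$). Let $v$ be a finite place of $K$, i.e. a nonzero prime ideal of $\mathcal O_K$ with $q\notin v$; put $k_v=\mathcal O_K/v$, let $q_v$ be the image of $q$ in $k_v$, and let $\mathcal A_v=\mathcal A\otimes_{\mathcal O_K}k_v$ carry the induced operators $\sigma_{q_v},\delta_{q_v},\partial$ (if $q_v=1$, then $\sigma_{q_v}=\mathrm{id}$ and $\delta_{q_v}=x\frac{d}{dx}$). For $(B,C)=(\mathcal A,\mathcal O_K)$ or $(\mathcal A_v,k_v)$, with $\sigma,\delta$ and $h=q-1$, resp. $h=q_v-1$, let $Diff_B$ be the category of finitely generated projective $B$-modules $N$ with an additive map $\Delta:N\to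 N$ such that $\Delta(an)=\sigma(a)\Delta(n)+\delta(a)n$; so $\Sigma=1+h\Delta$ is $\sigma$-semilinear, and $(N,\Delta)$ is a $q$- (resp. $q_v$-) difference module, or a differential module when $q_v=1$. Morphisms are the $B$-linear maps commuting with $\Delta$. The unit object is $(B,\delta)$, tensor products carry $\Delta\otimes1+\Sigma\otimes\Delta$, and a dual is an object $N^\vee$ identified with $\mathrm{Hom}_B(N,B)$ for which the evaluation $N^\vee\otimes N\to B$ is a morphism. The prolongation of $N$ is $F_\partial(N)=B[\partial]_{\le1}\otimes_BN$, with $\partial(an)=a\,\partial(n)+\partial(a)n$ and $\Delta(\partial(n))=\partial(\Delta n)$. For $\mathcal M\in Diff_B$ let $\langle\mathcal M\rangle^{\otimes}$ (resp. $\langle\mathcal M\rangle^{\otimes,\partial}$) be the smallest full subcategory of $Diff_B$ that contains $\mathcal M$ and the unit object and is closed under direct sums, tensor products, duals, quotients in $Diff_B$, and subobjects $W\hookrightarrow N$ in $Diff_B$ with $N/W$ flat over $C$ (no condition if $C$ is a field), and, resp., also under $F_\partial$. The generic Galois group $Gal(\mathcal M,\eta_B)\subset GL(\mathcal M)$ has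 as points with values in a $B$-algebra $S$ the automorphisms of $\mathcal M\otimes_BS$ induced by the tensor automorphisms of the functor $N\mapsto N\otimes_BS$ on $\langle\mathcal M\rangle^{\otimes}$. The parametrized generic Galois group $Gal^\partial(\mathcal M,\eta_B)$ has as points with values in a $\partial$-algebra $S$ over $(B,\partial)$ the automorphisms of $\mathcal M\otimes_BS$ induced by the tensor automorphisms $\lambda$ of $N\mapsto N\otimes_BS$ on $\langle\mathcal M\rangle^{\otimes,\partial}$ with $\lambda_{F_\partial(N)}=F_\partial(\lambda_N)$ for all $N$. Then for every object $\mathcal M$ of $Diff_{\mathcal A}$, inside $GL(\mathcal M\otimes_{\mathcal A}\mathcal A_v)=GL(\mathcal M)\otimes_{\mathcal A}\mathcal A_v$, $$Gal(\mathcal M\otimes_{\mathcal A}\mathcal A_v,\eta_{\mathcal A_v})\subset Gal(\mathcal M,\eta_{\mathcal A})\otimes_{\mathcal A}\mathcal A_v,$$ and, if $k$ has characteristic zero, $$Gal^{\partial}(\mathcal M\otimes_{\mathcal A}\mathcal A_v,\eta_{\mathcal A_v})\subset Gal^{\partial}(\mathcal M,\eta_{\mathcal A})\otimes_{\mathcal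 A}\mathcal A_v .$$ That is, for every $\mathcal A_v$-algebra (resp. every $\partial$-algebra over $\mathcal A_v$) $S$, every $S$-point of the left-hand side is an $S$-point of the group of $\mathcal M$. -/

import Mathlib

open scoped Polynomial TensorProduct

universe u w

noncomputable section

/-! ## Generalized differential rings of `q`-difference type -/

/-- A (commutative) generalized differential ring over `R` of `q`-difference type, together with a
derivation commuting with the structure.  The bimodule `Ω¹` is free of rank one as a right module,
`Ω¹ = dx · B`, with left multiplication `a · dx = dx · σ a` where `σ a = a + h δ a`, and
`d a = dx · δ a`; the Leibniz rule `d (a b) = a (d b) + (d a) b` is `δ_mul`.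
For `h = q - 1` the endomorphism `σ` is the `q`-difference operator and `δ = (σ - 1) / (q - 1)`;
for `h = 0` (that is `q = 1`) `σ` is the identity and `δ` is an ordinary derivation.
The derivation `der` plays the role of `∂ = x d/dx`. -/
structure QDRing (R : Type*) (B : Type*) [CommRing R] [CommRing B] [Algebra R B] where
  h : R
  δ : B →ₗ[R] B
  δ_one : δ 1 = 0
  δ_mul : ∀ a b, δ (a * b) = a * δ b + δ a * b + h • (δ a * δ b)
  der : Derivation R B B
  δ_der : ∀ a, δ (der a) = der (δ a)

namespace QDRing

variable {R B : Type*} [CommRing R] [CommRing B] [Algebra R B]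

/-- The endomorphism `σ = 1 + h δ`. -/
def σ (D : QDRing R B) (a : B) : B := a + D.h • D.δ a

/-- `algebraMap B B'` is a morphism of generalized differential rings, compatible with the
parameter `h` and with the derivations. -/
structure Compat {R' B' : Type*} [CommRing R'] [CommRing B'] [Algebra R' B'] [Algebra B B']
    (D : QDRing R B) (D' : QDRing R' B') : Prop where
  map_h : algebraMap R' B' D'.h = algebraMap B B' (algebraMap R B D.h)
  map_δ : ∀ b, D'.δ (algebraMap B B' b) = algebraMap B B' (D.δ b)
  map_der : ∀ b, D'.der (algebraMap B B' b) = algebraMap B B' (D.der b)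

/-- A `∂`-algebra over `(B, ∂)`: a `B`-algebra `S` with a derivation extending that of `B`. -/
structure DAlg (D : QDRing R B) (S : Type*) [CommRing S] [Algebra B S] where
  der : Derivation ℤ S S
  der_algebraMap : ∀ b, der (algebraMap B S b) = algebraMap B S (D.der b)

/-- Restriction of the base ring of a `∂`-algebra. -/
def DAlg.restrict {R' B' : Type*} [CommRing R'] [CommRing B'] [Algebra R' B'] [Algebra B B']
    {D : QDRing R B} {D' : QDRing R' B'} (c : Compat D D') {S : Type*} [CommRing S]
    [Algebra B S] [Algebra B' S] [IsScalarTower B B' S] (E : D'.DAlg S) : D.DAlg S where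
  der := E.der
  der_algebraMap b := by
    rw [IsScalarTower.algebraMap_apply B B' S, E.der_algebraMap, c.map_der,
      ← IsScalarTower.algebraMap_apply]

end QDRing

/-! ## Modules with connection -/

/-- Objects of `Diff_B`: finitely generated projective `B`-modules `M` with a connection
`∇ m = dx · Δ m`.  The rule `∇ (a m) = a ∇ m + d a ⊗ m` is `leibniz`.
Then `Σ = 1 + h Δ` is `σ`-semilinear; when `h = q - 1` is not a zero divisor, `Δ` is
`(Σ - 1) / (q - 1)`; when `h = 0`, the pair `(M, Δ)` is a differential module. -/
structure DMod {R : Type*} {B : Type u} [CommRing R] [CommRing B] [Algebra R B]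
    (D : QDRing R B) where
  carrier : Type u
  [addCommGroup : AddCommGroup carrier]
  [module : Module B carrier]
  [finite : Module.Finite B carrier]
  [projective : Module.Projective B carrier]
  Δ : carrier →+ carrier
  leibniz : ∀ (a : B) (m : carrier), Δ (a • m) = D.σ a • Δ m + D.δ a • m

namespace DMod

variable {R : Type*} {B : Type u} [CommRing R] [CommRing B] [Algebra R B] {D : QDRing R B}

instance : CoeSort (DMod D) (Type u) := ⟨DMod.carrier⟩

attribute [instance] DMod.addCommGroup DMod.module DMod.finite DMod.projective

/-- The semilinear operator `Σ = 1 + h Δ`. -/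
def Sig (N : DMod D) (n : N) : N := n + algebraMap R B D.h • N.Δ n

/-- Horizontal morphisms. -/
structure Hom (N N' : DMod D) where
  toLin : N →ₗ[B] N'
  horiz : ∀ n, toLin (N.Δ n) = N'.Δ (toLin n)

theorem σ_eq (a : B) : D.σ a = a + algebraMap R B D.h * D.δ a := by
  rw [QDRing.σ, Algebra.smul_def]

theorem δ_mul' (a b : B) : D.δ (a * b) = D.σ a * D.δ b + D.δ a * b := by
  rw [σ_eq, D.δ_mul, Algebra.smul_def]; ring

theorem σ_mul (a b : B) : D.σ (a * b) = D.σ a * D.σ b := by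
  simp only [σ_eq, D.δ_mul, Algebra.smul_def]; ring

theorem _root_.QDRing.Compat.map_σ {R' B' : Type*} [CommRing R'] [CommRing B'] [Algebra R' B']
    [Algebra B B'] {D' : QDRing R' B'} (c : QDRing.Compat D D') (b : B) :
    D'.σ (algebraMap B B' b) = algebraMap B B' (D.σ b) := by
  simp only [QDRing.σ, Algebra.smul_def, c.map_δ, c.map_h, map_add, map_mul]

/-- The unit object `(B, δ)`. -/
abbrev unit (D : QDRing R B) : DMod D where
  carrier := B
  Δ := D.δ.toAddMonoidHom
  leibniz a m := by simp [δ_mul']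

/-- Direct sums. -/
abbrev prod (N N' : DMod D) : DMod D where
  carrier := N × N'
  Δ := N.Δ.prodMap N'.Δ
  leibniz a m := by ext <;> simp [leibniz]

/-- The connection `Δ ⊗ 1 + Σ ⊗ Δ` on a tensor product, so that its operator `Σ` is `Σ ⊗ Σ`. -/
def tensorΔ (N N' : DMod D) : N ⊗[B] N' →+ N ⊗[B] N' :=
  TensorProduct.liftAddHom
    { toFun := fun n =>
        { toFun := fun n' => N.Δ n ⊗ₜ[B] n' + N.Sig n ⊗ₜ[B] N'.Δ n'
          map_zero' := by simp
          map_add' := fun x y => by simp only [map_add, TensorProduct.tmul_add]; abel }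
      map_zero' := by ext; simp [Sig]
      map_add' := fun x y => by
        ext n'
        simp only [Sig, map_add, TensorProduct.add_tmul, smul_add, AddMonoidHom.coe_mk,
          ZeroHom.coe_mk, AddMonoidHom.add_apply]
        abel }
    (fun r n n' => by
      simp only [Sig, leibniz, σ_eq, AddMonoidHom.coe_mk, ZeroHom.coe_mk, TensorProduct.add_tmul,
        TensorProduct.tmul_add, TensorProduct.tmul_smul, smul_add, ← TensorProduct.smul_tmul']
      module)

@[simp] theorem tensorΔ_tmul (N N' : DMod D) (n : N) (n' : N') :
    tensorΔ N N' (n ⊗ₜ n') = N.Δ n ⊗ₜ n' + N.Sig n ⊗ₜ N'.Δ n' := rfl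

/-- Tensor products. -/
abbrev tensor (N N' : DMod D) : DMod D where
  carrier := N ⊗[B] N'
  Δ := tensorΔ N N'
  leibniz a m := by
    induction m with
    | zero => simp
    | add x y hx hy => simp only [smul_add, map_add, hx, hy]; abel
    | tmul n n' =>
      simp only [TensorProduct.smul_tmul', tensorΔ_tmul, Sig, leibniz, σ_eq,
        TensorProduct.add_tmul, smul_add]
      simp only [← TensorProduct.smul_tmul']
      module

/-- `N'` is a dual of `N`: it is identified with `Hom_B (N, B)` in such a way that the evaluation
pairing `N' ⊗ N → B` is horizontal, that is `δ ⟨φ, n⟩ = ⟨Δ φ, Σ n⟩ + ⟨φ, Δ n⟩`. -/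
def IsDual (N N' : DMod D) : Prop :=
  ∃ e : N' ≃ₗ[B] Module.Dual B N, ∀ (φ : N') (n : N),
    D.δ (e φ n) = e (N'.Δ φ) (N.Sig n) + e φ (N.Δ n)

/-! ### Prolongation -/

/-- The underlying group of `B[∂]_{≤ 1} ⊗_B N`; the pair `(a, b)` stands for `a + ∂(b)`. -/
def Prol (_D : QDRing R B) (N : Type u) : Type u := N × N

namespace Prol

variable (D) (N : Type u) [AddCommGroup N] [Module B N]

instance : AddCommGroup (Prol D N) := inferInstanceAs (AddCommGroup (N × N))

/-- The left module structure given by `λ ∂(b) = ∂(λ b) - ∂(λ) b`. -/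
instance : Module B (Prol D N) where
  smul r z := (r • z.1 - D.der r • z.2, r • z.2)
  one_smul z := Prod.ext (show (1 : B) • z.1 - D.der 1 • z.2 = z.1 by simp)
    (show (1 : B) • z.2 = z.2 by simp)
  mul_smul r s z := Prod.ext
    (show (r * s) • z.1 - D.der (r * s) • z.2
        = r • (s • z.1 - D.der s • z.2) - D.der r • s • z.2 by
      simp only [Derivation.leibniz, smul_eq_mul]; module)
    (show (r * s) • z.2 = r • s • z.2 by module)
  smul_zero r := Prod.ext (show r • (0 : N) - D.der r • (0 : N) = 0 by simp)
    (show r • (0 : N) = 0 by simp)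
  smul_add r y z := Prod.ext
    (show r • (y.1 + z.1) - D.der r • (y.2 + z.2)
        = (r • y.1 - D.der r • y.2) + (r • z.1 - D.der r • z.2) by module)
    (show r • (y.2 + z.2) = r • y.2 + r • z.2 by module)
  add_smul r s z := Prod.ext
    (show (r + s) • z.1 - D.der (r + s) • z.2
        = (r • z.1 - D.der r • z.2) + (s • z.1 - D.der s • z.2) by
      simp only [map_add]; module)
    (show (r + s) • z.2 = r • z.2 + s • z.2 by module)
  zero_smul z := Prod.ext (show (0 : B) • z.1 - D.der 0 • z.2 = 0 by simp)
    (show (0 : B) • z.2 = 0 by simp)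

variable {D N}

theorem smul_def (r : B) (z : Prol D N) :
    r • z = ((r • z.1 - D.der r • z.2, r • z.2) : N × N) := rfl

variable (D N)

/-- The inclusion `n ↦ 1 ⊗ n`. -/
def incl : N →ₗ[B] Prol D N where
  toFun n := ((n, 0) : N × N)
  map_add' x y := Prod.ext rfl (show (0 : N) = 0 + 0 by simp)
  map_smul' r x := Prod.ext (show r • x = r • x - D.der r • (0 : N) by simp)
    (show (0 : N) = r • (0 : N) by simp)

/-- The additive map `n ↦ ∂(n) = ∂ ⊗ n`. -/
def del : N →+ Prol D N where
  toFun n := ((0, n) : N × N)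
  map_zero' := rfl
  map_add' x y := Prod.ext (show (0 : N) = 0 + 0 by simp) rfl

/-- The projection `a + ∂(b) ↦ b`. -/
def proj : Prol D N →ₗ[B] N where
  toFun z := z.2
  map_add' _ _ := rfl
  map_smul' _ _ := rfl

theorem del_smul (r : B) (n : N) : del D N (r • n) = r • del D N n + D.der r • incl D N n :=
  Prod.ext
    (show (0 : N) = (r • (0 : N) - D.der r • n) + (D.der r • n - D.der (D.der r) • (0 : N)) by simp)
    (show r • n = r • n + D.der r • (0 : N) by simp)

theorem exists_equiv [Module.Projective B N] : Nonempty ((N × N) ≃ₗ[B] Prol D N) := by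
  obtain ⟨s, hs⟩ := Module.projective_lifting_property (proj D N) LinearMap.id
    (fun n => ⟨del D N n, rfl⟩)
  have hs' : ∀ n, (s n).2 = n := fun n => LinearMap.congr_fun hs n
  refine ⟨LinearEquiv.ofBijective ((incl D N).coprod s) ⟨?_, ?_⟩⟩
  · rw [← LinearMap.ker_eq_bot, LinearMap.ker_eq_bot']
    rintro ⟨a, b⟩ hab
    have h2 : (0 : N) + (s b).2 = 0 := congrArg Prod.snd hab
    have hb : b = 0 := by simpa [hs'] using h2
    subst hb
    have h1 : a + (s 0).1 = 0 := congrArg Prod.fst hab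
    rw [map_zero] at h1
    have : a + 0 = 0 := h1
    simpa using this
  · intro z
    refine ⟨(z.1 - (s z.2).1, z.2), ?_⟩
    exact Prod.ext (show z.1 - (s z.2).1 + (s z.2).1 = z.1 by simp)
      (show (0 : N) + (s z.2).2 = z.2 by simp [hs'])

instance [Module.Projective B N] : Module.Projective B (Prol D N) :=
  Module.Projective.of_equiv (exists_equiv D N).some

instance [Module.Projective B N] [Module.Finite B N] : Module.Finite B (Prol D N) :=
  Module.Finite.equiv (exists_equiv D N).some

end Prol

/-- The prolongation functor `F_∂` on objects: `Δ (a + ∂(b)) = Δ a + ∂(Δ b)`. -/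
abbrev prolong (N : DMod D) : DMod D where
  carrier := Prol D N
  Δ := N.Δ.prodMap N.Δ
  leibniz a z := Prod.ext
    (show N.Δ (a • z.1 - D.der a • z.2)
        = (D.σ a • N.Δ z.1 - D.der (D.σ a) • N.Δ z.2) + (D.δ a • z.1 - D.der (D.δ a) • z.2) by
      simp only [map_sub, leibniz, QDRing.σ, map_add, D.δ_der, Derivation.map_smul]
      module)
    (show N.Δ (a • z.2) = D.σ a • N.Δ z.2 + D.δ a • z.2 from N.leibniz a z.2)

/-! ### The tensor categories generated by an object -/

/-- The cokernel of `f` is flat over the base ring `R`. -/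
def Hom.FlatCoker {W N : DMod D} (f : Hom W N) : Prop :=
  letI : Module R (N ⧸ LinearMap.range f.toLin) := Module.compHom _ (algebraMap R B)
  Module.Flat R (N ⧸ LinearMap.range f.toLin)

/-- The objects of the full subcategory `⟨M⟩^⊗` of `Diff_B` generated by `M` (for `p = False`),
and of `⟨M⟩^{⊗,∂}` (for `p = True`): the closure of `M` under direct sums, tensor products,
duals, subobjects and quotients, and in the second case also under prolongation.
Subobjects are the submodules with connection that are `R`-saturated, i.e. whose cokernel is
`R`-flat; this is no condition when `R` is a field, and over a Dedekind ring `R` it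
says that the quotient has no `R`-torsion. -/
inductive Gen (p : Prop) (M : DMod D) : DMod D → Prop
  | base : Gen p M M
  | unit : Gen p M (unit D)
  | prod {N N' : DMod D} : Gen p M N → Gen p M N' → Gen p M (N.prod N')
  | tensor {N N' : DMod D} : Gen p M N → Gen p M N' → Gen p M (N.tensor N')
  | dual {N N' : DMod D} : Gen p M N → IsDual N N' → Gen p M N'
  | sub {N W : DMod D} (f : Hom W N) : Gen p M N → Function.Injective f.toLin → f.FlatCoker →
      Gen p M W
  | quot {N Q : DMod D} (f : Hom N Q) : Gen p M N → Function.Surjective f.toLin → Gen p M Q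
  | prolong {N : DMod D} : p → Gen p M N → Gen p M N.prolong

/-! ### Tensor automorphisms of the forgetful functor -/

variable (S : Type w) [CommRing S] [Algebra B S]

/-- `S`-valued points of `Aut^⊗` of the forgetful functor restricted to `⟨M⟩^⊗`
(resp. `⟨M⟩^{⊗,∂}`): families of `S`-linear automorphisms of `S ⊗ N`, natural in `N` and
compatible with the unit object and with tensor products. -/
structure TensorAut (p : Prop) (M : DMod D) where
  app : ∀ N : DMod D, Gen p M N → (S ⊗[B] N) ≃ₗ[S] (S ⊗[B] N)
  natural : ∀ {N N' : DMod D} (hN : Gen p M N) (hN' : Gen p M N') (f : Hom N N') (z : S ⊗[B] N),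
    app N' hN' (f.toLin.baseChange S z) = f.toLin.baseChange S (app N hN z)
  app_unit : ∀ z : S ⊗[B] unit D, app (unit D) .unit z = z
  app_tensor : ∀ {N N' : DMod D} (hN : Gen p M N) (hN' : Gen p M N') (z : S ⊗[B] (N ⊗[B] N')),
    TensorProduct.AlgebraTensorModule.distribBaseChange B S N N'
        (app (N.tensor N') (.tensor hN hN') z) =
      TensorProduct.map (app N hN).toLinearMap (app N' hN').toLinearMap
        (TensorProduct.AlgebraTensorModule.distribBaseChange B S N N' z)

namespace TensorAut

variable {S} {p : Prop} {M : DMod D}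

/-- The identity. -/
def one : TensorAut S p M where
  app _ _ := 1
  natural _ _ _ _ := rfl
  app_unit _ := rfl
  app_tensor _ _ z := by
    change _ = TensorProduct.map LinearMap.id LinearMap.id _
    rw [TensorProduct.map_id]; rfl

/-- Composition. -/
def mul (l l' : TensorAut S p M) : TensorAut S p M where
  app N hN := l.app N hN * l'.app N hN
  natural hN hN' f z := by simp only [LinearEquiv.mul_apply, l.natural hN hN', l'.natural hN hN']
  app_unit z := by simp only [LinearEquiv.mul_apply, l.app_unit, l'.app_unit]
  app_tensor hN hN' z := by
    refine (l.app_tensor hN hN' _).trans ?_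
    refine (congrArg _ (l'.app_tensor hN hN' z)).trans ?_
    rw [← LinearMap.comp_apply, ← TensorProduct.map_comp]
    rfl

/-- Inverse. -/
def inv (l : TensorAut S p M) : TensorAut S p M where
  app N hN := (l.app N hN).symm
  natural hN hN' f z := by
    rw [LinearEquiv.symm_apply_eq, l.natural hN hN', LinearEquiv.apply_symm_apply]
  app_unit z := by rw [LinearEquiv.symm_apply_eq, l.app_unit]
  app_tensor hN hN' z := by
    obtain ⟨y, rfl⟩ := (l.app _ (.tensor hN hN')).surjective z
    rw [l.app_tensor hN hN', LinearEquiv.symm_apply_apply, ← LinearMap.comp_apply,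
      ← TensorProduct.map_comp]
    simp

end TensorAut

/-- The group of `S`-points of the generic Galois group `Gal(M, η_B)`, inside
`GL(M)(S) = Aut_S (S ⊗ M)`. -/
def Gal (M : DMod D) : Subgroup ((S ⊗[B] M) ≃ₗ[S] (S ⊗[B] M)) where
  carrier := {g | ∃ l : TensorAut S False M, l.app M .base = g}
  one_mem' := ⟨.one, rfl⟩
  mul_mem' := by
    rintro _ _ ⟨l, rfl⟩ ⟨l', rfl⟩
    exact ⟨l.mul l', rfl⟩
  inv_mem' := by
    rintro _ ⟨l, rfl⟩
    exact ⟨l.inv, rfl⟩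

variable {S}

/-- The map `∂ : S ⊗ N → F_∂(S ⊗ N) = S ⊗ F_∂(N)`, `∂ (s ⊗ n) = ∂(s) ⊗ n + s ⊗ ∂(n)`. -/
def delS (E : D.DAlg S) (N : DMod D) : S ⊗[B] N →+ S ⊗[B] Prol D N :=
  TensorProduct.liftAddHom
    { toFun := fun s =>
        { toFun := fun n => E.der s ⊗ₜ[B] Prol.incl D N n + s ⊗ₜ[B] Prol.del D N n
          map_zero' := by simp
          map_add' := fun x y => by simp only [map_add, TensorProduct.tmul_add]; abel }
      map_zero' := by ext; simp
      map_add' := fun x y => by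
        ext n
        simp only [map_add, TensorProduct.add_tmul, AddMonoidHom.coe_mk,
          ZeroHom.coe_mk, AddMonoidHom.add_apply]
        abel }
    (fun r s n => by
      simp only [AddMonoidHom.coe_mk, ZeroHom.coe_mk, Prol.del_smul, map_smul,
        TensorProduct.tmul_add, TensorProduct.tmul_smul, TensorProduct.smul_tmul',
        Algebra.smul_def r s, Algebra.smul_def r (E.der s), Algebra.smul_def (D.der r) s,
        Derivation.leibniz, E.der_algebraMap, smul_eq_mul, TensorProduct.add_tmul]
      rw [mul_comm s]
      abel)

/-- The group of `S`-points of the parametrized generic Galois group `Gal^∂(M, η_B)`, for a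
`∂`-algebra `S` over `B`: the tensor automorphisms `l` of the forgetful functor on `⟨M⟩^{⊗,∂}`
with `l_{F_∂(N)} = F_∂(l_N)`. On `S ⊗ N ⊆ S ⊗ F_∂(N)` the latter holds by naturality, so that it
amounts to the condition on `∂(S ⊗ N)` imposed here. -/
def GalDer (E : D.DAlg S) (M : DMod D) : Subgroup ((S ⊗[B] M) ≃ₗ[S] (S ⊗[B] M)) where
  carrier := {g | ∃ l : TensorAut S True M, l.app M .base = g ∧
    ∀ (N : DMod D) (hN : Gen True M N) (z : S ⊗[B] N),
      l.app N.prolong (.prolong trivial hN) (delS E N z) = delS E N (l.app N hN z)}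
  one_mem' := ⟨.one, rfl, fun _ _ _ => rfl⟩
  mul_mem' := by
    rintro _ _ ⟨l, rfl, h⟩ ⟨l', rfl, h'⟩
    refine ⟨l.mul l', rfl, fun N hN z => ?_⟩
    simp only [TensorAut.mul, LinearEquiv.mul_apply]
    rw [h' N hN, h N hN]
  inv_mem' := by
    rintro _ ⟨l, rfl, h⟩
    refine ⟨l.inv, rfl, fun N hN z => ?_⟩
    simp only [TensorAut.inv]
    rw [LinearEquiv.symm_apply_eq, h N hN, LinearEquiv.apply_symm_apply]

/-! ### Base change -/

section BaseChange

variable {R' : Type*} {B' : Type u} [CommRing R'] [CommRing B'] [Algebra R' B'] [Algebra B B']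
  {D' : QDRing R' B'}

/-- The connection on `B' ⊗ N`: `Δ (b ⊗ n) = δ b ⊗ n + σ b ⊗ Δ n`. -/
def baseChangeΔ (c : QDRing.Compat D D') (N : DMod D) : B' ⊗[B] N →+ B' ⊗[B] N :=
  TensorProduct.liftAddHom
    { toFun := fun b =>
        { toFun := fun n => D'.δ b ⊗ₜ[B] n + D'.σ b ⊗ₜ[B] N.Δ n
          map_zero' := by simp
          map_add' := fun x y => by simp only [map_add, TensorProduct.tmul_add]; abel }
      map_zero' := by ext; simp [QDRing.σ]
      map_add' := fun x y => by
        ext n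
        simp only [map_add, TensorProduct.add_tmul, AddMonoidHom.coe_mk, QDRing.σ, smul_add,
          ZeroHom.coe_mk, AddMonoidHom.add_apply]
        abel }
    (fun r b n => by
      simp only [AddMonoidHom.coe_mk, ZeroHom.coe_mk, leibniz, TensorProduct.tmul_add,
        TensorProduct.tmul_smul, Algebra.smul_def r b, δ_mul', σ_mul, c.map_δ, c.map_σ]
      have key : algebraMap B B' (D.σ r) * D'.δ b + algebraMap B B' (D.δ r) * b
          = r • D'.δ b + D.δ r • D'.σ b := by
        simp only [σ_eq, Algebra.smul_def, c.map_h, map_add, map_mul]; ring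
      rw [key, ← Algebra.smul_def, TensorProduct.add_tmul]
      simp only [TensorProduct.smul_tmul']
      abel)

@[simp] theorem baseChangeΔ_tmul (c : QDRing.Compat D D') (N : DMod D) (b : B') (n : N) :
    baseChangeΔ c N (b ⊗ₜ n) = D'.δ b ⊗ₜ n + D'.σ b ⊗ₜ N.Δ n := rfl

/-- The base change functor `Diff_B → Diff_{B'}` on objects. -/
abbrev baseChange (c : QDRing.Compat D D') (N : DMod D) : DMod D' where
  carrier := B' ⊗[B] N
  Δ := baseChangeΔ c N
  leibniz a m := by
    induction m with
    | zero => simp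
    | add x y hx hy => simp only [smul_add, map_add, hx, hy]; abel
    | tmul b n =>
      simp only [TensorProduct.smul_tmul', baseChangeΔ_tmul, smul_eq_mul, δ_mul', σ_mul,
        TensorProduct.add_tmul, smul_add]
      abel

/-- The identification `GL(M)(S) = GL(M ⊗ B')(S)` for a `B'`-algebra `S`: an automorphism of
`S ⊗_{B'} (B' ⊗_B M)` viewed as an automorphism of `S ⊗_B M`. -/
def descend (c : QDRing.Compat D D') (M : DMod D) {S : Type w} [CommRing S] [Algebra B S]
    [Algebra B' S] [IsScalarTower B B' S]
    (g : (S ⊗[B'] (M.baseChange c)) ≃ₗ[S] (S ⊗[B'] (M.baseChange c))) :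
    (S ⊗[B] M) ≃ₗ[S] (S ⊗[B] M) :=
  (TensorProduct.AlgebraTensorModule.cancelBaseChange B B' S S M).symm ≪≫ₗ g ≪≫ₗ
    TensorProduct.AlgebraTensorModule.cancelBaseChange B B' S S M

end BaseChange

end DMod

/-! ## Reduction modulo an ideal of constants -/

namespace QDRing

/-- `B_{R'} = B ⊗_R R'`. -/
def Red (R R' : Type u) (B : Type u) [CommRing R] [CommRing R'] [CommRing B] [Algebra R R']
    [Algebra R B] : Type u := R' ⊗[R] B

section Red

variable (R R' : Type u) (B : Type u) [CommRing R] [CommRing R'] [CommRing B] [Algebra R R']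
  [Algebra R B]

instance : CommRing (Red R R' B) := inferInstanceAs (CommRing (R' ⊗[R] B))
instance : Algebra R' (Red R R' B) := inferInstanceAs (Algebra R' (R' ⊗[R] B))
instance : Algebra B (Red R R' B) :=
  (Algebra.TensorProduct.includeRight : B →ₐ[R] R' ⊗[R] B).toRingHom.toAlgebra

variable {R B}

/-- The derivation `∂ ⊗ 1`. -/
def redDer (D : QDRing R B) : Derivation R' (Red R R' B) (Red R R' B) :=
  Derivation.mk' (LinearMap.baseChange R' (D.der : B →ₗ[R] B) : R' ⊗[R] B →ₗ[R'] R' ⊗[R] B)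
    (by
      change ∀ a b : R' ⊗[R] B, LinearMap.baseChange R' (D.der : B →ₗ[R] B) (a * b) =
        a * LinearMap.baseChange R' (D.der : B →ₗ[R] B) b +
          b * LinearMap.baseChange R' (D.der : B →ₗ[R] B) a
      intro a b
      induction a with
      | zero => simp
      | add x y hx hy => simp only [add_mul, mul_add, map_add, hx, hy]; ring
      | tmul r x =>
        induction b with
        | zero => simp
        | add x y hx hy => simp only [add_mul, mul_add, map_add, hx, hy]; ring
        | tmul s y =>
          simp [TensorProduct.tmul_add, mul_comm s r])

/-- The generalized differential ring `(B ⊗_R R', δ ⊗ 1, ∂ ⊗ 1)` over `R'`. -/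
def red (D : QDRing R B) : QDRing R' (Red R R' B) where
  h := algebraMap R R' D.h
  δ := (LinearMap.baseChange R' D.δ : R' ⊗[R] B →ₗ[R'] R' ⊗[R] B)
  δ_one := by
    change LinearMap.baseChange R' D.δ ((1 : R') ⊗ₜ[R] (1 : B)) = 0
    simp [D.δ_one]
  δ_mul := by
    change ∀ a b : R' ⊗[R] B, LinearMap.baseChange R' D.δ (a * b) =
      a * LinearMap.baseChange R' D.δ b + LinearMap.baseChange R' D.δ a * b +
        algebraMap R R' D.h • (LinearMap.baseChange R' D.δ a * LinearMap.baseChange R' D.δ b)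
    intro a b
    induction a with
    | zero => simp
    | add x y hx hy => simp only [add_mul, map_add, hx, hy, smul_add]; ring
    | tmul r x =>
      induction b with
      | zero => simp
      | add x y hx hy => simp only [mul_add, map_add, hx, hy, smul_add]; ring
      | tmul s y =>
        simp [TensorProduct.tmul_add, D.δ_mul, algebraMap_smul]
  der := D.redDer R'
  δ_der := by
    change ∀ a : R' ⊗[R] B,
      LinearMap.baseChange R' D.δ (LinearMap.baseChange R' (D.der : B →ₗ[R] B) a) =
      LinearMap.baseChange R' (D.der : B →ₗ[R] B) (LinearMap.baseChange R' D.δ a)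
    intro a
    induction a with
    | zero => simp
    | add x y hx hy => simp only [map_add, hx, hy]
    | tmul r x => simp [D.δ_der]

/-- The projection `B → B ⊗_R R'` is a morphism of generalized differential rings. -/
theorem red_compat (D : QDRing R B) : Compat D (D.red R') where
  map_h := by
    change (algebraMap R R' D.h) ⊗ₜ[R] (1 : B) = (1 : R') ⊗ₜ[R] (algebraMap R B D.h)
    rw [Algebra.algebraMap_eq_smul_one, Algebra.algebraMap_eq_smul_one, TensorProduct.smul_tmul]
  map_δ b := by
    change LinearMap.baseChange R' D.δ ((1 : R') ⊗ₜ[R] b) = (1 : R') ⊗ₜ[R] D.δ b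
    simp
  map_der b := by
    change LinearMap.baseChange R' (D.der : B →ₗ[R] B) ((1 : R') ⊗ₜ[R] b) = (1 : R') ⊗ₜ[R] D.der b
    simp

end Red

end QDRing

/-! ## Rational functions -/

namespace QRat

section Rat

variable (K : Type u) [Field K]

theorem algebraMap_eq_aeval (p : K[X]) :
    algebraMap K[X] (RatFunc K) p = Polynomial.aeval (RatFunc.X : RatFunc K) p := by
  have : IsScalarTower.toAlgHom K K[X] (RatFunc K) = Polynomial.aeval (RatFunc.X : RatFunc K) :=
    Polynomial.algHom_ext (by simp)
  exact DFunLike.congr_fun this p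

theorem fst_aeval (p : K[X]) :
    (Polynomial.aeval (TrivSqZeroExt.inl RatFunc.X + TrivSqZeroExt.inr RatFunc.X :
      TrivSqZeroExt (RatFunc K) (RatFunc K)) p).fst = algebraMap K[X] (RatFunc K) p := by
  have : (TrivSqZeroExt.fstHom K (RatFunc K) (RatFunc K)).comp
      (Polynomial.aeval (TrivSqZeroExt.inl RatFunc.X + TrivSqZeroExt.inr RatFunc.X))
      = Polynomial.aeval (RatFunc.X : RatFunc K) :=
    Polynomial.algHom_ext (by simp)
  rw [algebraMap_eq_aeval]
  exact DFunLike.congr_fun this p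

/-- The ring homomorphism `f ↦ f(x + ε x) = f(x) + ε x f'(x)` to the dual numbers. -/
def dualLift : RatFunc K →+* TrivSqZeroExt (RatFunc K) (RatFunc K) :=
  IsLocalization.lift (M := nonZeroDivisors K[X])
    (g := (Polynomial.aeval (TrivSqZeroExt.inl RatFunc.X + TrivSqZeroExt.inr RatFunc.X :
      TrivSqZeroExt (RatFunc K) (RatFunc K)) : K[X] →ₐ[K] _).toRingHom)
    (by
      intro y
      rw [TrivSqZeroExt.isUnit_iff_isUnit_fst, isUnit_iff_ne_zero]
      have h := fst_aeval K (y : K[X])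
      refine fun h0 => nonZeroDivisors.ne_zero y.2 ?_
      exact (map_eq_zero_iff _ (IsFractionRing.injective K[X] (RatFunc K))).1 (h.symm.trans h0))

theorem dualLift_algebraMap (p : K[X]) : dualLift K (algebraMap K[X] (RatFunc K) p) =
    Polynomial.aeval (TrivSqZeroExt.inl RatFunc.X + TrivSqZeroExt.inr RatFunc.X) p :=
  IsLocalization.lift_eq _ _

theorem fst_dualLift (f : RatFunc K) : (dualLift K f).fst = f := by
  have : (TrivSqZeroExt.fstHom K (RatFunc K) (RatFunc K)).toRingHom.comp (dualLift K)
      = RingHom.id _ := by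
    refine IsLocalization.ringHom_ext (nonZeroDivisors K[X]) (RingHom.ext fun p => ?_)
    change (dualLift K (algebraMap K[X] (RatFunc K) p)).fst = algebraMap K[X] (RatFunc K) p
    rw [dualLift_algebraMap, fst_aeval]
  exact DFunLike.congr_fun this f

/-- The derivation `∂ = x d/dx` of `K(x)`. -/
def theta : Derivation K (RatFunc K) (RatFunc K) :=
  Derivation.mk'
    { toFun := fun f => (dualLift K f).snd
      map_add' := fun f g => by simp
      map_smul' := fun c f => by
        have hc : dualLift K (algebraMap K (RatFunc K) c) =
            algebraMap K (TrivSqZeroExt (RatFunc K) (RatFunc K)) c := by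
          rw [IsScalarTower.algebraMap_apply K K[X] (RatFunc K), dualLift_algebraMap]
          simp
        rw [Algebra.smul_def c f, map_mul, hc, ← Algebra.smul_def]
        rfl }
    (fun f g => by
      change (dualLift K (f * g)).snd = f • (dualLift K g).snd + g • (dualLift K f).snd
      rw [map_mul, TrivSqZeroExt.snd_mul, fst_dualLift, fst_dualLift, op_smul_eq_smul])

theorem theta_X : theta K RatFunc.X = RatFunc.X := by
  change (dualLift K RatFunc.X).snd = RatFunc.X
  rw [← RatFunc.algebraMap_X, dualLift_algebraMap]
  simp

variable {K}

theorem comp_mem_nonZeroDivisors {q : K} (hq : q ≠ 0) :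
    nonZeroDivisors K[X] ≤ (nonZeroDivisors K[X]).comap
      (Polynomial.aeval (Polynomial.C q * Polynomial.X) : K[X] →ₐ[K] K[X]) := by
  refine nonZeroDivisors_le_comap_nonZeroDivisors_of_injective _ ?_
  let _ := invertibleOfNonzero hq
  have h := (Polynomial.algEquivCMulXAddC q 0).injective
  intro a b hab
  apply h
  simpa [Polynomial.algEquivCMulXAddC] using hab

/-- The `q`-difference operator `f(x) ↦ f(qx)` of `K(x)`. -/
def sigma {q : K} (hq : q ≠ 0) : RatFunc K →ₐ[K] RatFunc K :=
  RatFunc.mapAlgHom (Polynomial.aeval (Polynomial.C q * Polynomial.X))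
    (comp_mem_nonZeroDivisors hq)

theorem sigma_algebraMap {q : K} (hq : q ≠ 0) (p : K[X]) :
    sigma hq (algebraMap K[X] (RatFunc K) p) =
      algebraMap K[X] (RatFunc K) (Polynomial.aeval (Polynomial.C q * Polynomial.X) p) := by
  have := RatFunc.map_apply_div (Polynomial.aeval (Polynomial.C q * Polynomial.X) : K[X] →ₐ[K] K[X])
    (comp_mem_nonZeroDivisors hq) p 1
  simpa [sigma, RatFunc.coe_mapAlgHom_eq_coe_map] using this

theorem sigma_X {q : K} (hq : q ≠ 0) :
    sigma hq RatFunc.X = algebraMap K (RatFunc K) q * RatFunc.X := by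
  rw [← RatFunc.algebraMap_X, sigma_algebraMap]
  simp [RatFunc.algebraMap_C]

theorem theta_sigma {q : K} (hq : q ≠ 0) (f : RatFunc K) :
    theta K (sigma hq f) = sigma hq (theta K f) := by
  have hpoly : ∀ p : K[X], theta K (sigma hq (algebraMap K[X] (RatFunc K) p))
      = sigma hq (theta K (algebraMap K[X] (RatFunc K) p)) := by
    intro p
    rw [algebraMap_eq_aeval, ← Polynomial.aeval_algHom_apply, Derivation.map_aeval,
      Derivation.map_aeval, sigma_X, smul_eq_mul, smul_eq_mul, map_mul (sigma hq), theta_X, sigma_X,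
      ← Polynomial.aeval_algHom_apply, sigma_X, ← Algebra.smul_def, Derivation.map_smul, theta_X]
  induction f using RatFunc.induction_on with
  | f p r hr =>
    simp only [map_div₀, Derivation.leibniz_div, hpoly, smul_eq_mul, map_mul, map_sub, map_pow,
      map_inv₀]

end Rat

section Ring

variable {K : Type u} [Field K] {O : Type u} [CommRing O] [Algebra O K]

/-- The algebra `O[x, 1/P(x), 1/P(qx), 1/P(q²x), …]` inside `K(x)`. -/
def ringA (q : O) (P : O[X]) : Subalgebra O (RatFunc K) :=
  Algebra.adjoin O (insert RatFunc.X
    (Set.range fun i : ℕ =>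
      (Polynomial.aeval (algebraMap O (RatFunc K) (q ^ i) * RatFunc.X) P)⁻¹))

variable {q : O} (hq0 : algebraMap O K q ≠ 0)

/-- `δ_q f = (f(qx) - f(x)) / (q - 1)`. -/
def deltaK : RatFunc K →ₗ[O] RatFunc K :=
  ((algebraMap O K q - 1)⁻¹ •
    ((sigma hq0).toLinearMap - (LinearMap.id : RatFunc K →ₗ[K] RatFunc K))).restrictScalars O

theorem deltaK_apply (f : RatFunc K) :
    deltaK hq0 f = (algebraMap O K q - 1)⁻¹ • (sigma hq0 f - f) := rfl

theorem sigma_eq (hq1 : algebraMap O K q ≠ 1) (f : RatFunc K) : sigma hq0 f = f + (q - 1) • deltaK hq0 f := by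
  have h : algebraMap O K q - 1 ≠ 0 := sub_ne_zero.2 hq1
  rw [deltaK_apply, ← algebraMap_smul K (q - 1), map_sub, map_one, smul_smul, mul_inv_cancel₀ h,
    one_smul]
  ring

theorem deltaK_mul' (f g : RatFunc K) :
    deltaK hq0 (f * g) = sigma hq0 f * deltaK hq0 g + deltaK hq0 f * g := by
  simp only [deltaK_apply, map_mul, Algebra.smul_def]; ring

theorem deltaK_mul (hq1 : algebraMap O K q ≠ 1) (f g : RatFunc K) :
    deltaK hq0 (f * g) = f * deltaK hq0 g + deltaK hq0 f * g
      + (q - 1) • (deltaK hq0 f * deltaK hq0 g) := by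
  rw [deltaK_mul', sigma_eq hq0 hq1, add_mul, smul_mul_assoc]; ring

theorem deltaK_algebraMap (c : O) : deltaK hq0 (algebraMap O (RatFunc K) c) = 0 := by
  rw [deltaK_apply, IsScalarTower.algebraMap_apply O K (RatFunc K), AlgHom.commutes, sub_self,
    smul_zero]

theorem sigma_point (i : ℕ) : sigma hq0 (algebraMap O (RatFunc K) (q ^ i) * RatFunc.X)
    = algebraMap O (RatFunc K) (q ^ (i + 1)) * RatFunc.X := by
  rw [map_mul, sigma_X, IsScalarTower.algebraMap_apply O K (RatFunc K), AlgHom.commutes,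
    IsScalarTower.algebraMap_apply O K (RatFunc K) (q ^ (i + 1)), pow_succ, map_mul, map_mul]
  ring

variable (P : O[X])

theorem X_mem : (RatFunc.X : RatFunc K) ∈ ringA q P :=
  Algebra.subset_adjoin (Set.mem_insert _ _)

theorem inv_mem (i : ℕ) :
    (Polynomial.aeval (algebraMap O (RatFunc K) (q ^ i) * RatFunc.X) P)⁻¹ ∈ ringA (K := K) q P :=
  Algebra.subset_adjoin (Set.mem_insert_of_mem _ ⟨i, rfl⟩)

theorem point_mem (i : ℕ) :
    algebraMap O (RatFunc K) (q ^ i) * RatFunc.X ∈ ringA (K := K) q P :=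
  mul_mem (Subalgebra.algebraMap_mem _ _) (X_mem P)

theorem aeval_mem (i : ℕ) (p : O[X]) :
    Polynomial.aeval (algebraMap O (RatFunc K) (q ^ i) * RatFunc.X) p ∈ ringA (K := K) q P :=
  Algebra.adjoin_le (Set.singleton_subset_iff.2 (point_mem P i))
    (Polynomial.aeval_mem_adjoin_singleton O _)

theorem deltaK_X (hq1 : algebraMap O K q ≠ 1) : deltaK hq0 (RatFunc.X : RatFunc K) = RatFunc.X := by
  have h : algebraMap O K q - 1 ≠ 0 := sub_ne_zero.2 hq1
  rw [deltaK_apply, sigma_X, ← Algebra.smul_def, show (algebraMap O K q) • (RatFunc.X : RatFunc K)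
    - RatFunc.X = (algebraMap O K q - 1) • RatFunc.X by rw [sub_smul, one_smul], smul_smul,
    inv_mul_cancel₀ h, one_smul]

theorem deltaK_aeval_mem (hq1 : algebraMap O K q ≠ 1) (P : O[X]) (i : ℕ) (p : O[X]) :
    deltaK hq0 (Polynomial.aeval (algebraMap O (RatFunc K) (q ^ i) * RatFunc.X) p)
      ∈ ringA (K := K) q P := by
  induction p using Polynomial.induction_on' with
  | add a b ha hb => rw [map_add, map_add]; exact add_mem ha hb
  | monomial n c =>
    rw [Polynomial.aeval_monomial, ← Algebra.smul_def, map_smul]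
    refine Subalgebra.smul_mem _ ?_ _
    induction n with
    | zero =>
      rw [pow_zero, ← map_one (algebraMap O (RatFunc K)), deltaK_algebraMap]
      exact zero_mem _
    | succ n ih =>
      rw [pow_succ, deltaK_mul hq0 hq1, ← Algebra.smul_def, map_smul, deltaK_X hq0 hq1,
        Algebra.smul_def]
      have hx := point_mem (K := K) (q := q) P i
      exact add_mem (add_mem (mul_mem (pow_mem hx n) hx) (mul_mem ih hx))
        (Subalgebra.smul_mem _ (mul_mem ih hx) _)

theorem deltaK_mem (hq1 : algebraMap O K q ≠ 1) (P : O[X]) {f : RatFunc K} (hf : f ∈ ringA q P) : deltaK hq0 f ∈ ringA q P := by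
  induction hf using Algebra.adjoin_induction with
  | mem f hf =>
    rcases hf with rfl | ⟨i, rfl⟩
    · rw [deltaK_X hq0 hq1]; exact X_mem P
    · set y := Polynomial.aeval (algebraMap O (RatFunc K) (q ^ i) * RatFunc.X) P with hy
      have hs : sigma hq0 y =
          Polynomial.aeval (algebraMap O (RatFunc K) (q ^ (i + 1)) * RatFunc.X) P := by
        rw [hy, ← sigma_point hq0 i]
        exact (Polynomial.aeval_algHom_apply ((sigma hq0).restrictScalars O) _ P).symm
      have hd : deltaK hq0 y ∈ ringA q P := deltaK_aeval_mem hq0 hq1 P i P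
      change deltaK hq0 y⁻¹ ∈ _
      rcases eq_or_ne y 0 with h0 | h0
      · rw [h0, inv_zero, map_zero]; exact zero_mem _
      · have h1 : sigma hq0 y ≠ 0 := by simpa using h0
        have : deltaK hq0 y⁻¹ = -((sigma hq0 y)⁻¹ * y⁻¹ * deltaK hq0 y) := by
          simp only [deltaK_apply, map_inv₀, Algebra.smul_def]
          field_simp
          ring
        rw [this]
        exact neg_mem (mul_mem (mul_mem (hs ▸ inv_mem P (i + 1)) (inv_mem P i)) hd)
  | algebraMap r => rw [deltaK_algebraMap]; exact zero_mem _
  | add a b _ _ ha hb => rw [map_add]; exact add_mem ha hb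
  | mul a b ha' hb' ha hb =>
    rw [deltaK_mul hq0 hq1]
    exact add_mem (add_mem (mul_mem ha' hb) (mul_mem ha hb'))
      (Subalgebra.smul_mem _ (mul_mem ha hb) _)

theorem theta_algebraMap (c : O) : theta K (algebraMap O (RatFunc K) c) = 0 := by
  rw [IsScalarTower.algebraMap_apply O K (RatFunc K)]; exact (theta K).map_algebraMap _

theorem theta_aeval_mem (i : ℕ) :
    theta K (Polynomial.aeval (algebraMap O (RatFunc K) (q ^ i) * RatFunc.X) P)
      ∈ ringA (K := K) q P := by
  have h : theta K (algebraMap O (RatFunc K) (q ^ i) * RatFunc.X)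
      = algebraMap O (RatFunc K) (q ^ i) * RatFunc.X := by
    rw [Derivation.leibniz, theta_algebraMap, theta_X, smul_zero, add_zero, smul_eq_mul]
  have h2 := Derivation.map_aeval ((theta K).restrictScalars O) P
    (algebraMap O (RatFunc K) (q ^ i) * RatFunc.X)
  change theta K _ = _ • theta K _ at h2
  rw [h2, h]
  exact mul_mem (aeval_mem P i _) (point_mem P i)

theorem theta_mem {f : RatFunc K} (hf : f ∈ ringA q P) : theta K f ∈ ringA q P := by
  induction hf using Algebra.adjoin_induction with
  | mem f hf =>
    rcases hf with rfl | ⟨i, rfl⟩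
    · rw [theta_X]; exact X_mem P
    · change theta K (_)⁻¹ ∈ _
      rw [Derivation.leibniz_inv]
      exact mul_mem (neg_mem (pow_mem (inv_mem P i) 2)) (theta_aeval_mem P i)
  | algebraMap r => rw [theta_algebraMap]; exact zero_mem _
  | add a b _ _ ha hb => rw [map_add]; exact add_mem ha hb
  | mul a b ha' hb' ha hb =>
    rw [Derivation.leibniz]
    exact add_mem (mul_mem ha' hb) (mul_mem hb' ha)

/-- The generalized differential ring `(𝒜, δ_q)`, `𝒜 = O[x, 1/P(x), 1/P(qx), …]`, with
`h = q - 1`, `δ_q f = (f(qx) - f(x)) / (q - 1)` and `∂ = x d/dx`. -/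
def qdRing (hq1 : algebraMap O K q ≠ 1) (P : O[X]) : QDRing O (ringA (K := K) q P) where
  h := q - 1
  δ := (deltaK hq0).restrict (p := Subalgebra.toSubmodule (ringA q P))
    (q := Subalgebra.toSubmodule (ringA q P)) (fun _ hf => deltaK_mem hq0 hq1 P hf)
  δ_one := Subtype.ext (by
    change deltaK hq0 (1 : RatFunc K) = 0
    rw [← map_one (algebraMap O (RatFunc K)), deltaK_algebraMap])
  δ_mul a b := Subtype.ext (deltaK_mul hq0 hq1 (a : RatFunc K) b)
  der := Derivation.mk'
    ((((theta K).restrictScalars O : Derivation O (RatFunc K) (RatFunc K)) :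
        RatFunc K →ₗ[O] RatFunc K).restrict (p := Subalgebra.toSubmodule (ringA q P))
      (q := Subalgebra.toSubmodule (ringA q P)) (fun _ hf => theta_mem P hf))
    (fun a b => Subtype.ext ((theta K).leibniz (a : RatFunc K) b))
  δ_der a := Subtype.ext (by
    change deltaK hq0 (theta K (a : RatFunc K)) = theta K (deltaK hq0 (a : RatFunc K))
    rw [deltaK_apply, deltaK_apply, Derivation.map_smul, map_sub, theta_sigma])

end Ring
end QRat

/-! ## The parameter `q` and its specializations -/

namespace QSpec

open FunctionField

variable (k K : Type u) [Field k] [Field K] [Algebra k[X] K]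

/-- The parameter `q`, i.e. the variable of `k(q)`, as an element of the integral closure
`O_K` of `k[q]` in `K`. -/
def q : ringOfIntegers k K := algebraMap k[X] (ringOfIntegers k K) Polynomial.X

theorem algebraMap_q (k K : Type u) [Field k] [Field K] [Algebra k[X] K] :
    algebraMap (ringOfIntegers k K) K (q k K) =
      algebraMap k[X] K Polynomial.X :=
  (IsScalarTower.algebraMap_apply k[X] (ringOfIntegers k K) K _).symm

variable [Algebra (RatFunc k) K] [IsScalarTower k[X] (RatFunc k) K]

theorem q_ne_zero : algebraMap (ringOfIntegers k K) K (q k K) ≠ 0 := by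
  rw [algebraMap_q, Ne, map_eq_zero_iff _ (FunctionField.algebraMap_injective k K)]
  exact Polynomial.X_ne_zero

theorem q_ne_one : algebraMap (ringOfIntegers k K) K (q k K) ≠ 1 := by
  rw [algebraMap_q, ← map_one (algebraMap k[X] K), Ne,
    (FunctionField.algebraMap_injective k K).eq_iff]
  exact fun h => by simpa using congrArg Polynomial.natDegree h

variable {k K}

/-- The ring `𝒜 = O_K[x, 1/P(x), 1/P(qx), …] ⊆ K(x)`. -/
abbrev A (P : (ringOfIntegers k K)[X]) :=
  QRat.ringA (K := K) (q k K) P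

/-- The generalized differential ring `(𝒜, δ_q)` over `O_K`, with the derivation `x d/dx`. -/
abbrev ringA (P : (ringOfIntegers k K)[X]) : QDRing (ringOfIntegers k K) (A P) :=
  QRat.qdRing (q_ne_zero k K) (q_ne_one k K) P

/-- The residue field `k_v = O_K / v`. -/
abbrev resField (v : IsDedekindDomain.HeightOneSpectrum (ringOfIntegers k K)) : Type u :=
  ringOfIntegers k K ⧸ v.asIdeal

/-- `𝒜_v = 𝒜 ⊗_{O_K} k_v`. -/
abbrev Av (P : (ringOfIntegers k K)[X])
    (v : IsDedekindDomain.HeightOneSpectrum (ringOfIntegers k K)) : Type u :=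
  QDRing.Red (ringOfIntegers k K) (resField v) (A P)

/-- The projection `𝒜 → 𝒜_v` is a morphism of generalized differential rings. -/
theorem compat (P : (ringOfIntegers k K)[X])
    (v : IsDedekindDomain.HeightOneSpectrum (ringOfIntegers k K)) :
    QDRing.Compat (ringA P) ((ringA P).red (resField v)) :=
  (ringA P).red_compat (resField v)

/-- The specialization `ℳ ⊗_𝒜 𝒜_v`, an object of `Diff_{𝒜_v}`. -/
abbrev spec {P : (ringOfIntegers k K)[X]} (M : DMod (ringA P))
    (v : IsDedekindDomain.HeightOneSpectrum (ringOfIntegers k K)) :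
    DMod ((ringA P).red (resField v)) :=
  M.baseChange (compat P v)

end QSpec

end

/-! ### Horizontal isomorphisms -/

noncomputable section

namespace DMod

variable {R : Type*} {B : Type u} [CommRing R] [CommRing B] [Algebra R B] {D : QDRing R B}

/-! Base change to the residue field is a tensor functor from the category generated by ℳ to the one
generated by its reduction ℳ_v, and it commutes with the fibre functors: S ⊗_{𝒜_v} (𝒜_v ⊗_𝒜 N) = S
⊗_𝒜 N. A tensor automorphism over the reduced category can therefore be pulled back along this
functor, and its component at ℳ does not change. The inclusion of groups expresses just this
pullback.

The real content is that the functor lands in the category generated by ℳ_v (`Gen.baseChange`,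
`Gen.red`). The proof is by induction on the construction of N. Unit, sums, tensor products and
prolongations commute with base change up to horizontal isomorphism. Duals do so because the modules
are finitely generated projective, and quotients are preserved by right exactness. For a subobject W
of N, flatness of N/W over O_K makes Tor₁(N/W, k_v) vanish, so W stays a subobject after reduction
(`injective_baseChange_red`); over the field k_v its cokernel is automatically flat. This step is
the reason for the saturation condition on subobjects.

Pulling back (`TensorAut.descend`) uses that the identification of fibres is natural and monoidal.
In the parametrized case one also needs that the isomorphism between base change of the prolongation
and prolongation of the base change respects ∂ (`baseChangeProlong_delS`); compatibility with F_∂ is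
then inherited. -/

/-- The inverse of a bijective horizontal morphism. -/
def Hom.symm {N N' : DMod D} (f : Hom N N') (hf : Function.Bijective f.toLin) : Hom N' N where
  toLin := (LinearEquiv.ofBijective f.toLin hf).symm.toLinearMap
  horiz n := by
    obtain ⟨n, rfl⟩ := (LinearEquiv.ofBijective f.toLin hf).surjective n
    rw [LinearEquiv.coe_coe, LinearEquiv.symm_apply_apply, LinearEquiv.symm_apply_eq]
    exact (f.horiz n).symm

/-- The class of objects generated by `M` is closed under horizontal isomorphisms. -/
theorem Gen.of_bijective {p : Prop} {M N N' : DMod D} (hN' : Gen p M N') (f : Hom N N')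
    (hf : Function.Bijective f.toLin) : Gen p M N :=
  -- The generating rules contain no closure under isomorphism, but an isomorphic copy is in
  -- particular a quotient.
  .quot (f.symm hf) hN' (LinearEquiv.ofBijective f.toLin hf).symm.surjective

/-! ### Base change of morphisms, units, sums and tensor products -/

section BaseChange

variable {R' : Type*} {B' : Type u} [CommRing R'] [CommRing B'] [Algebra R' B'] [Algebra B B']
  {D' : QDRing R' B'}

theorem _root_.QDRing.σ_one (D : QDRing R B) : D.σ 1 = 1 := by
  rw [QDRing.σ, D.δ_one, smul_zero, add_zero]

theorem baseChangeΔ_one_tmul (c : QDRing.Compat D D') (N : DMod D) (n : N) :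
    baseChangeΔ c N (1 ⊗ₜ n) = 1 ⊗ₜ N.Δ n := by
  rw [baseChangeΔ_tmul, D'.δ_one, D'.σ_one, TensorProduct.zero_tmul, zero_add]

/-- Since h moves across the tensor sign, b ⊗ n and h δ(b) ⊗ n combine to σ(b) ⊗ n. This
multiplicative form is what tensor products and duals use. -/
theorem Sig_baseChange_tmul (c : QDRing.Compat D D') (N : DMod D) (b : B') (n : N) :
    (N.baseChange c).Sig (b ⊗ₜ[B] n) = D'.σ b ⊗ₜ[B] N.Sig n := by
  have h : algebraMap R' B' D'.h • D'.σ b ⊗ₜ[B] N.Δ n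
      = D'.σ b ⊗ₜ[B] (algebraMap R B D.h • N.Δ n) := by
    rw [c.map_h, algebraMap_smul, TensorProduct.tmul_smul]
  simp only [Sig, baseChangeΔ_tmul, smul_add, h, TensorProduct.tmul_add]
  rw [← add_assoc, TensorProduct.smul_tmul', ← TensorProduct.add_tmul, smul_eq_mul, ← σ_eq]

/-- A `B'`-linear map out of `B' ⊗ N` is horizontal as soon as it is horizontal on `1 ⊗ N`. -/
def Hom.ofBaseChange (c : QDRing.Compat D D') {N : DMod D} {N' : DMod D'}
    (f : B' ⊗[B] N →ₗ[B'] N') (h : ∀ n, f (1 ⊗ₜ N.Δ n) = N'.Δ (f (1 ⊗ₜ n))) :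
    Hom (N.baseChange c) N' where
  toLin := f
  horiz z := by
    have h' : ∀ (b : B') (n : N), f (b ⊗ₜ n) = b • f (1 ⊗ₜ n) := fun b n => by
      rw [← map_smul, TensorProduct.smul_tmul', smul_eq_mul, mul_one]
    induction z using TensorProduct.induction_on with
    | zero => rw [map_zero, map_zero, map_zero]
    | add x y hx hy => rw [map_add, map_add, map_add, map_add, hx, hy]
    -- The formula for Δ(b ⊗ n) is the Leibniz rule of the target applied to b • f(1 ⊗ n).
    | tmul b n =>
      rw [baseChangeΔ_tmul, map_add, h' b, h' (D'.δ b), h' (D'.σ b), N'.leibniz, h, add_comm]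

/-- Base change of horizontal morphisms. -/
def Hom.baseChange (c : QDRing.Compat D D') {N N' : DMod D} (f : Hom N N') :
    Hom (N.baseChange c) (N'.baseChange c) :=
  .ofBaseChange c (f.toLin.baseChange B') fun n => by
    rw [LinearMap.baseChange_tmul, LinearMap.baseChange_tmul, baseChangeΔ_one_tmul, f.horiz]

/-- Base change preserves the unit object. -/
def baseChangeUnit (c : QDRing.Compat D D') : Hom ((unit D).baseChange c) (unit D') :=
  .ofBaseChange c (TensorProduct.AlgebraTensorModule.rid B B' B').toLinearMap fun b => by
    change D.δ b • (1 : B') = D'.δ (b • (1 : B'))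
    rw [← Algebra.algebraMap_eq_smul_one, ← Algebra.algebraMap_eq_smul_one, c.map_δ]

theorem baseChangeUnit_bijective (c : QDRing.Compat D D') :
    Function.Bijective (baseChangeUnit c).toLin :=
  (TensorProduct.AlgebraTensorModule.rid B B' B').bijective

/-- Base change preserves direct sums. -/
def baseChangeProd (c : QDRing.Compat D D') (N N' : DMod D) :
    Hom ((N.prod N').baseChange c) ((N.baseChange c).prod (N'.baseChange c)) :=
  .ofBaseChange c (TensorProduct.prodRight B B' B' N N').toLinearMap fun n =>
    Prod.ext (baseChangeΔ_one_tmul c N n.1).symm (baseChangeΔ_one_tmul c N' n.2).symm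

theorem baseChangeProd_bijective (c : QDRing.Compat D D') (N N' : DMod D) :
    Function.Bijective (baseChangeProd c N N').toLin :=
  (TensorProduct.prodRight B B' B' N N').bijective

/-- On vectors 1 ⊗ n the twist disappears because σ(1) = 1 and δ(1) = 0. By `Hom.ofBaseChange`,
checking these vectors is enough for horizontality. -/
theorem distribBaseChange_tensorΔ (c : QDRing.Compat D D') (N N' : DMod D) (z : N ⊗[B] N') :
    TensorProduct.AlgebraTensorModule.distribBaseChange B B' N N' (1 ⊗ₜ tensorΔ N N' z) =
      tensorΔ (N.baseChange c) (N'.baseChange c)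
        (TensorProduct.AlgebraTensorModule.distribBaseChange B B' N N' (1 ⊗ₜ z)) := by
  induction z using TensorProduct.induction_on with
  | zero => simp only [map_zero, TensorProduct.tmul_zero]
  | add x y hx hy => simp only [map_add, TensorProduct.tmul_add, hx, hy]
  | tmul n n' =>
    refine Eq.trans ?_ (tensorΔ_tmul (N.baseChange c) (N'.baseChange c) (1 ⊗ₜ n) (1 ⊗ₜ n')).symm
    rw [Sig_baseChange_tmul, D'.σ_one]
    simp only [baseChangeΔ_one_tmul, tensorΔ_tmul, TensorProduct.tmul_add, map_add,
      TensorProduct.AlgebraTensorModule.distribBaseChange_tmul]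

/-- Base change preserves tensor products. -/
def baseChangeTensor (c : QDRing.Compat D D') (N N' : DMod D) :
    Hom ((N.tensor N').baseChange c) ((N.baseChange c).tensor (N'.baseChange c)) :=
  .ofBaseChange c (TensorProduct.AlgebraTensorModule.distribBaseChange B B' N N').toLinearMap
    (distribBaseChange_tensorΔ c N N')

theorem baseChangeTensor_bijective (c : QDRing.Compat D D') (N N' : DMod D) :
    Function.Bijective (baseChangeTensor c N N').toLin :=
  (TensorProduct.AlgebraTensorModule.distribBaseChange B B' N N').bijective

/-! ### Duals -/

/-- The canonical map `B' ⊗ Hom(N, B) → Hom(B' ⊗ N, B')`. -/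
def dualBaseChange (B' : Type*) [CommRing B'] [Algebra B B'] (N : Type*) [AddCommGroup N]
    [Module B N] : B' ⊗[B] Module.Dual B N →ₗ[B'] Module.Dual B' (B' ⊗[B] N) :=
  (Module.Dual.baseChange B' (R := B) (V := N)).liftBaseChange B'

theorem dualBaseChange_tmul (B' : Type*) [CommRing B'] [Algebra B B'] (N : Type*) [AddCommGroup N]
    [Module B N] (b b' : B') (φ : Module.Dual B N) (n : N) :
    dualBaseChange B' N (b ⊗ₜ φ) (b' ⊗ₜ n) = b * b' * algebraMap B B' (φ n) := by
  simp [dualBaseChange, Algebra.smul_def]; ring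

/-- A finitely generated projective module has a finite dual basis (e i, φ i), and this survives
base change: the inverse sends ψ to ∑ ψ(1 ⊗ e i) ⊗ φ i. -/
theorem dualBaseChange_bijective (B' : Type*) [CommRing B'] [Algebra B B'] (N : Type*)
    [AddCommGroup N] [Module B N] [Module.Finite B N] [Module.Projective B N] :
    Function.Bijective (dualBaseChange (B := B) B' N) := by
  obtain ⟨m, f, g, -, -, hfg⟩ := Module.Finite.exists_comp_eq_id_of_projective B N
  -- N is a retract of the free module on `Fin m`; `e` and `φ` are the images of the standard basis
  -- and the coordinates of the section.
  let e : Fin m → N := fun i => f (Pi.single i 1)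
  let φ : Fin m → Module.Dual B N := fun i => LinearMap.proj i ∘ₗ g
  have hN : ∀ n : N, ∑ i, φ i n • e i = n := fun n => by
    conv_rhs => rw [← LinearMap.id_apply (R := B) n, ← hfg, LinearMap.comp_apply,
      pi_eq_sum_univ' (g n), map_sum]
    simp [φ, e]
  have hφ : ∀ ψ : Module.Dual B N, ∑ i, ψ (e i) • φ i = ψ := fun ψ => by
    ext n
    conv_rhs => rw [← hN n]
    simp [mul_comm]
  refine Function.bijective_iff_has_inverse.2
    ⟨fun ψ => ∑ i, ψ (1 ⊗ₜ e i) ⊗ₜ φ i, fun z => ?_, fun ψ => ?_⟩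
  · induction z using TensorProduct.induction_on with
    | zero => simp
    | add x y hx hy =>
      dsimp only at hx hy ⊢
      simp only [map_add, LinearMap.add_apply, TensorProduct.add_tmul, Finset.sum_add_distrib,
        hx, hy]
    | tmul b ψ =>
      conv_rhs => rw [← hφ ψ, TensorProduct.tmul_sum]
      refine Finset.sum_congr rfl fun i _ => ?_
      rw [dualBaseChange_tmul, mul_one, mul_comm, ← Algebra.smul_def, TensorProduct.smul_tmul]
  · ext n
    have h : (1 : B') ⊗ₜ[B] n = ∑ i, algebraMap B B' (φ i n) • (1 : B') ⊗ₜ[B] e i := by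
      conv_lhs => rw [← hN n, TensorProduct.tmul_sum]
      exact Finset.sum_congr rfl fun i _ => by rw [algebraMap_smul, TensorProduct.tmul_smul]
    change dualBaseChange B' N (∑ i, ψ (1 ⊗ₜ e i) ⊗ₜ φ i) (1 ⊗ₜ n) = ψ (1 ⊗ₜ n)
    conv_rhs => rw [h, map_sum]
    rw [map_sum, LinearMap.sum_apply]
    exact Finset.sum_congr rfl fun i _ => by
      rw [map_smul, dualBaseChange_tmul, smul_eq_mul, mul_one, mul_comm]

/-- Base change preserves duals. -/
theorem IsDual.baseChange (c : QDRing.Compat D D') {N N' : DMod D} (h : IsDual N N') :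
    IsDual (N.baseChange c) (N'.baseChange c) := by
  obtain ⟨e, he⟩ := h
  refine ⟨(e.baseChange B B' N' (Module.Dual B N)) ≪≫ₗ
    LinearEquiv.ofBijective (dualBaseChange B' N) (dualBaseChange_bijective B' N), ?_⟩
  intro φ n
  induction φ using TensorProduct.induction_on with
  | zero => simp
  | add x y hx hy =>
    simp only [map_add, LinearMap.add_apply, hx, hy]; abel
  | tmul b φ =>
    induction n using TensorProduct.induction_on with
    | zero => simp [Sig]
    | add x y hx hy =>
      have : (N.baseChange c).Sig (x + y) = (N.baseChange c).Sig x + (N.baseChange c).Sig y := by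
        simp only [Sig, map_add, smul_add]; abel
      simp only [this, map_add, hx, hy]; abel
    | tmul b' n =>
      simp only [Sig_baseChange_tmul, baseChangeΔ_tmul, LinearEquiv.trans_apply,
        LinearEquiv.baseChange_tmul, LinearEquiv.ofBijective_apply, map_add, LinearMap.add_apply,
        dualBaseChange_tmul]
      -- The extended pairing is b b' ⟨φ, n⟩. After the twisted Leibniz rule on this triple product,
      -- horizontality of the original pairing and ⟨φ, Σn⟩ = ⟨φ, n⟩ + h ⟨φ, Δn⟩ leave a polynomial
      -- identity.
      have h1 := congrArg (algebraMap B B') (he φ n)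
      rw [map_add] at h1
      rw [δ_mul', δ_mul', c.map_δ, h1, σ_mul]
      have h2 : algebraMap B B' (e φ (N.Sig n)) = algebraMap B B' (e φ n)
          + algebraMap R' B' D'.h * algebraMap B B' (e φ (N.Δ n)) := by
        simp only [Sig, map_add, map_smul, smul_eq_mul, map_mul, c.map_h]
      rw [h2]
      simp only [σ_eq]
      ring

/-! ### Prolongations -/

/-- `(B', ∂)` as a `∂`-algebra over itself. -/
def _root_.QDRing.Compat.dAlg (c : QDRing.Compat D D') : D.DAlg B' where
  der := D'.der.restrictScalars ℤ
  der_algebraMap := c.map_der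

@[simp] theorem delS_tmul {S : Type*} [CommRing S] [Algebra B S] (E : D.DAlg S) (N : DMod D)
    (s : S) (n : N) : delS E N (s ⊗ₜ n) =
      E.der s ⊗ₜ[B] Prol.incl D N n + s ⊗ₜ[B] Prol.del D N n := rfl

theorem Prol.incl_add_del (N : Type u) [AddCommGroup N] [Module B N] (z : Prol D N) :
    Prol.incl D N z.1 + Prol.del D N z.2 = z :=
  Prod.ext (add_zero z.1) (zero_add z.2)

/-- The map `b ⊗ (m + ∂(n)) ↦ b ⊗ m - ∂(b) ⊗ n + ∂(b ⊗ n)`. -/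
def baseChangeProlAdd (D : QDRing R B) (D' : QDRing R' B') (c : QDRing.Compat D D')
    (N : Type u) [AddCommGroup N] [Module B N] :
    B' ⊗[B] Prol D N →+ Prol D' (B' ⊗[B] N) :=
  TensorProduct.liftAddHom
    { toFun := fun b =>
        -- The correction term comes from b ∂(n) = ∂(b n) - ∂(b) n.
        { toFun := fun z => ((b ⊗ₜ[B] z.1 - D'.der b ⊗ₜ[B] z.2, b ⊗ₜ[B] z.2) :
            (B' ⊗[B] N) × (B' ⊗[B] N))
          map_zero' := Prod.ext
            (show b ⊗ₜ[B] (0 : N) - D'.der b ⊗ₜ[B] (0 : N) = 0 by simp)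
            (show b ⊗ₜ[B] (0 : N) = 0 by simp)
          map_add' := fun x y => Prod.ext
            (show b ⊗ₜ[B] (x.1 + y.1) - D'.der b ⊗ₜ[B] (x.2 + y.2) =
                (b ⊗ₜ[B] x.1 - D'.der b ⊗ₜ[B] x.2) + (b ⊗ₜ[B] y.1 - D'.der b ⊗ₜ[B] y.2) by
              simp only [TensorProduct.tmul_add]; abel)
            (show b ⊗ₜ[B] (x.2 + y.2) = b ⊗ₜ[B] x.2 + b ⊗ₜ[B] y.2 from
              TensorProduct.tmul_add _ _ _) }
      map_zero' := AddMonoidHom.ext fun z => Prod.ext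
        (show (0 : B') ⊗ₜ[B] z.1 - D'.der 0 ⊗ₜ[B] z.2 = 0 by simp)
        (show (0 : B') ⊗ₜ[B] z.2 = 0 by simp)
      map_add' := fun x y => AddMonoidHom.ext fun z => Prod.ext
        (show (x + y) ⊗ₜ[B] z.1 - D'.der (x + y) ⊗ₜ[B] z.2 =
            (x ⊗ₜ[B] z.1 - D'.der x ⊗ₜ[B] z.2) + (y ⊗ₜ[B] z.1 - D'.der y ⊗ₜ[B] z.2) by
          simp only [TensorProduct.add_tmul, map_add]; abel)
        (show (x + y) ⊗ₜ[B] z.2 = x ⊗ₜ[B] z.2 + y ⊗ₜ[B] z.2 from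
          TensorProduct.add_tmul _ _ _) }
    (fun r b z => Prod.ext
      (show (r • b) ⊗ₜ[B] z.1 - D'.der (r • b) ⊗ₜ[B] z.2 =
          b ⊗ₜ[B] (r • z.1 - D.der r • z.2) - D'.der b ⊗ₜ[B] (r • z.2) by
        rw [Algebra.smul_def r b, Derivation.leibniz, c.map_der, smul_eq_mul, smul_eq_mul,
          mul_comm b, ← Algebra.smul_def, ← Algebra.smul_def, ← Algebra.smul_def,
          TensorProduct.tmul_sub, TensorProduct.add_tmul]
        simp only [TensorProduct.smul_tmul]
        abel)
      (show (r • b) ⊗ₜ[B] z.2 = b ⊗ₜ[B] (r • z.2) from TensorProduct.smul_tmul _ _ _))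

theorem baseChangeProlAdd_tmul (c : QDRing.Compat D D') (N : Type u) [AddCommGroup N] [Module B N]
    (b : B') (z : Prol D N) : baseChangeProlAdd D D' c N (b ⊗ₜ z) =
      ((b ⊗ₜ[B] z.1 - D'.der b ⊗ₜ[B] z.2, b ⊗ₜ[B] z.2) : (B' ⊗[B] N) × (B' ⊗[B] N)) := rfl

/-- The inverse sends x + ∂(y) to x plus the derivative of y, where ∂ on B' ⊗ N is `delS` for B' as
a ∂-algebra. -/
theorem baseChangeProlAdd_bijective (c : QDRing.Compat D D') (N : DMod D) :
    Function.Bijective (baseChangeProlAdd D D' c N) := by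
  refine Function.bijective_iff_has_inverse.2
    ⟨fun z => (Prol.incl D N).baseChange B' z.1 + delS c.dAlg N z.2, fun z => ?_, fun z => ?_⟩
  · induction z using TensorProduct.induction_on with
    | zero =>
      rw [map_zero]
      change (Prol.incl D N).baseChange B' 0 + delS c.dAlg N 0 = 0
      rw [map_zero, map_zero, add_zero]
    | add x y hx hy =>
      rw [map_add]
      conv_rhs => rw [← hx, ← hy]
      generalize baseChangeProlAdd D D' c N x = x
      generalize baseChangeProlAdd D D' c N y = y
      change (Prol.incl D N).baseChange B' (x.1 + y.1) + delS c.dAlg N (x.2 + y.2) = _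
      rw [map_add, map_add]
      exact add_add_add_comm _ _ _ _
    | tmul b z =>
      rw [baseChangeProlAdd_tmul]
      simp only [map_sub, LinearMap.baseChange_tmul, delS_tmul]
      change _ - _ + (D'.der b ⊗ₜ[B] Prol.incl D N z.2 + _) = _
      rw [← add_assoc, sub_add_cancel, ← TensorProduct.tmul_add, Prol.incl_add_del]
  · obtain ⟨x, y⟩ := z
    dsimp only
    have hx : ∀ x : B' ⊗[B] N, baseChangeProlAdd D D' c N ((Prol.incl D N).baseChange B' x) =
        Prol.incl D' (B' ⊗[B] N) x := fun x => by
      induction x with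
      | zero => simp
      | add x y hx hy => simp only [map_add, hx, hy]
      | tmul b n =>
        rw [LinearMap.baseChange_tmul, baseChangeProlAdd_tmul]
        exact Prod.ext (show b ⊗ₜ[B] n - D'.der b ⊗ₜ[B] (0 : N) = b ⊗ₜ[B] n by simp)
          (show b ⊗ₜ[B] (0 : N) = 0 by simp)
    have hy : ∀ y : B' ⊗[B] N, baseChangeProlAdd D D' c N (delS c.dAlg N y) =
        Prol.del D' (B' ⊗[B] N) y := fun y => by
      induction y with
      | zero => simp
      | add x y hx hy => simp only [map_add, hx, hy]
      | tmul b n =>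
        rw [delS_tmul, map_add, baseChangeProlAdd_tmul, baseChangeProlAdd_tmul]
        refine Prod.ext (show (D'.der b ⊗ₜ[B] n - D'.der (D'.der b) ⊗ₜ[B] (0 : N)) +
          (b ⊗ₜ[B] (0 : N) - D'.der b ⊗ₜ[B] n) = 0 by simp)
          (show D'.der b ⊗ₜ[B] (0 : N) + b ⊗ₜ[B] n = b ⊗ₜ[B] n by simp)
    rw [map_add, hx, hy]
    exact Prol.incl_add_del (D := D') (B' ⊗[B] N) (x, y)

/-- Base change commutes with prolongation. -/
def baseChangeProlong (c : QDRing.Compat D D') (N : DMod D) :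
    Hom (N.prolong.baseChange c) (N.baseChange c).prolong :=
  .ofBaseChange c
    { toFun := baseChangeProlAdd D D' c N
      map_add' := map_add _
      map_smul' := fun r z => by
        induction z using TensorProduct.induction_on with
        | zero => simp
        | add x y hx hy =>
          simp only [smul_add, map_add, RingHom.id_apply] at hx hy ⊢
          rw [hx, hy]
        | tmul b z =>
          rw [TensorProduct.smul_tmul', baseChangeProlAdd_tmul, baseChangeProlAdd_tmul]
          refine Prod.ext
            (show (r • b) ⊗ₜ[B] z.1 - D'.der (r • b) ⊗ₜ[B] z.2 =
              r • (b ⊗ₜ[B] z.1 - D'.der b ⊗ₜ[B] z.2) - D'.der r • (b ⊗ₜ[B] z.2) from ?_)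
            (show (r • b) ⊗ₜ[B] z.2 = r • (b ⊗ₜ[B] z.2) from rfl)
          rw [smul_eq_mul, Derivation.leibniz, smul_sub, TensorProduct.add_tmul]
          simp only [TensorProduct.smul_tmul', smul_eq_mul, mul_comm b]
          abel }
    fun z => Prod.ext
      (show (1 : B') ⊗ₜ[B] N.Δ z.1 - D'.der 1 ⊗ₜ[B] N.Δ z.2 =
          baseChangeΔ c N (1 ⊗ₜ[B] z.1 - D'.der 1 ⊗ₜ[B] z.2) by
        simp only [Derivation.map_one_eq_zero, TensorProduct.zero_tmul, sub_zero,
          baseChangeΔ_one_tmul])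
      (baseChangeΔ_one_tmul c N z.2).symm

theorem baseChangeProlong_bijective (c : QDRing.Compat D D') (N : DMod D) :
    Function.Bijective (baseChangeProlong c N).toLin :=
  baseChangeProlAdd_bijective c N

/-! ### Specialization of the generated categories and of tensor automorphisms -/

/-- Vector spaces are free, hence flat. -/
theorem Hom.flatCoker_of_isField (hR : IsField R) {W N : DMod D} (f : Hom W N) : f.FlatCoker := by
  let := hR.toField
  unfold Hom.FlatCoker
  let : Module R (N ⧸ LinearMap.range f.toLin) := Module.compHom _ (algebraMap R B)
  exact @Module.Flat.of_free R _ _ _ _ (Module.Free.of_divisionRing (K := R) _)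

/-- If base change to `B'` preserves the saturated subobjects, it maps `⟨M⟩^⊗` to `⟨M ⊗ B'⟩^⊗`,
and `⟨M⟩^{⊗,∂}` to `⟨M ⊗ B'⟩^{⊗,∂}`. -/
theorem Gen.baseChange (c : QDRing.Compat D D')
    (hc : ∀ {W N : DMod D} (f : Hom W N), Function.Injective f.toLin → f.FlatCoker →
      Function.Injective (f.baseChange c).toLin ∧ (f.baseChange c).FlatCoker)
    {p : Prop} {M N : DMod D} (hN : Gen p M N) :
    Gen p (M.baseChange c) (N.baseChange c) := by
  -- Isomorphisms are absorbed by `Gen.of_bijective`. Being a dual is a relation, so it transfers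
  -- directly. Only the subobject case needs `hc`.
  induction hN with
  | base => exact .base
  | unit =>
    exact Gen.unit.of_bijective _ (baseChangeUnit_bijective c)
  | prod _ _ h h' => exact (h.prod h').of_bijective _ (baseChangeProd_bijective c _ _)
  | tensor _ _ h h' => exact (h.tensor h').of_bijective _ (baseChangeTensor_bijective c _ _)
  | dual _ hd h => exact h.dual (hd.baseChange c)
  | sub f _ hf hf' h => exact h.sub (f.baseChange c) (hc f hf hf').1 (hc f hf hf').2
  | quot f _ hf h => exact h.quot (f.baseChange c) (LinearMap.lTensor_surjective B' hf)
  | prolong hp _ h => exact (h.prolong hp).of_bijective _ (baseChangeProlong_bijective c _)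

/-! ### Descent of tensor automorphisms -/

section Descent

variable {S : Type w} [CommRing S] [Algebra B S] [Algebra B' S] [IsScalarTower B B' S]

theorem baseChange_bijective {C : Type*} [CommRing C] [Algebra C S] {N N' : Type*}
    [AddCommGroup N] [Module C N] [AddCommGroup N'] [Module C N'] {f : N →ₗ[C] N'}
    (hf : Function.Bijective f) : Function.Bijective (f.baseChange S) :=
  ((LinearEquiv.ofBijective f hf).baseChange C S N N').bijective

/-- This allows calculations with descended automorphisms by writing each element as the image of
some `y` over B'. -/
theorem descend_cancelBaseChange (c : QDRing.Compat D D') (N : DMod D)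
    (g : (S ⊗[B'] (N.baseChange c)) ≃ₗ[S] (S ⊗[B'] (N.baseChange c)))
    (y : S ⊗[B'] (N.baseChange c)) :
    descend c N g (TensorProduct.AlgebraTensorModule.cancelBaseChange B B' S S N y) =
      TensorProduct.AlgebraTensorModule.cancelBaseChange B B' S S N (g y) := by
  simp only [descend, LinearEquiv.trans_apply, LinearEquiv.symm_apply_apply]

/-- Naturality in N of the identification of the two fibre functors. -/
theorem cancelBaseChange_baseChange (c : QDRing.Compat D D') {N N' : DMod D} (f : Hom N N')
    (y : S ⊗[B'] (N.baseChange c)) :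
    f.toLin.baseChange S (TensorProduct.AlgebraTensorModule.cancelBaseChange B B' S S N y) =
      TensorProduct.AlgebraTensorModule.cancelBaseChange B B' S S N'
        ((f.baseChange c).toLin.baseChange S y) := by
  induction y using TensorProduct.induction_on with
  | zero => simp only [map_zero]
  | add x y hx hy => simp only [map_add, hx, hy]
  | tmul s z =>
    induction z using TensorProduct.induction_on with
    | zero => simp only [map_zero, TensorProduct.tmul_zero]
    | add x y hx hy => simp only [map_add, TensorProduct.tmul_add, hx, hy]
    | tmul b n => rfl

/-- The identification of the two fibre functors is monoidal; both routes can be compared on pure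
tensors. -/
theorem distribBaseChange_cancelBaseChange (c : QDRing.Compat D D') (N N' : DMod D)
    (y : S ⊗[B'] ((N.tensor N').baseChange c)) :
    TensorProduct.AlgebraTensorModule.distribBaseChange B S N N'
        (TensorProduct.AlgebraTensorModule.cancelBaseChange B B' S S (N.tensor N') y) =
      TensorProduct.map
        (TensorProduct.AlgebraTensorModule.cancelBaseChange B B' S S N).toLinearMap
        (TensorProduct.AlgebraTensorModule.cancelBaseChange B B' S S N').toLinearMap
        (TensorProduct.AlgebraTensorModule.distribBaseChange B' S (N.baseChange c)
          (N'.baseChange c) ((baseChangeTensor c N N').toLin.baseChange S y)) := by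
  induction y using TensorProduct.induction_on with
  | zero => simp only [map_zero]
  | add x y hx hy => simp only [map_add, hx, hy]
  | tmul s z =>
    induction z using TensorProduct.induction_on with
    | zero => simp only [map_zero, TensorProduct.tmul_zero]
    | add x y hx hy => simp only [map_add, TensorProduct.tmul_add, hx, hy]
    | tmul b n =>
      induction n using TensorProduct.induction_on with
      | zero => simp only [map_zero, TensorProduct.tmul_zero]
      | add x y hx hy => simp only [map_add, TensorProduct.tmul_add, hx, hy]
      | tmul n n' =>
        -- `distribBaseChange` puts the whole scalar on the first factor, so the two sides differ
        -- only by 1 • 1 in the second.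
        change (b • s) ⊗ₜ[B] n ⊗ₜ[S] ((1 : S) ⊗ₜ[B] n') =
          (b • s) ⊗ₜ[B] n ⊗ₜ[S] (((1 : B') • (1 : S)) ⊗ₜ[B] n')
        rw [one_smul]

/-- The prolongation isomorphism sends 1 ⊗ ∂(n) to ∂(1 ⊗ n), its correction term vanishing because
∂(1) = 0. Hence the operators ∂ on the fibres over B and over B' correspond. -/
theorem baseChangeProlong_delS (c : QDRing.Compat D D') (E : D'.DAlg S) (N : DMod D)
    (z : S ⊗[B] N) :
    (baseChangeProlong c N).toLin.baseChange S
        ((TensorProduct.AlgebraTensorModule.cancelBaseChange B B' S S N.prolong).symm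
          (delS (E.restrict c) N z)) =
      delS E (N.baseChange c)
        ((TensorProduct.AlgebraTensorModule.cancelBaseChange B B' S S N).symm z) := by
  induction z using TensorProduct.induction_on with
  | zero => simp only [map_zero]
  | add x y hx hy => simp only [map_add, hx, hy]
  | tmul s n =>
    have h1 : baseChangeProlAdd D D' c N (1 ⊗ₜ Prol.incl D N n) =
        Prol.incl D' (B' ⊗[B] N) (1 ⊗ₜ n) :=
      Prod.ext (show (1 : B') ⊗ₜ[B] n - D'.der 1 ⊗ₜ[B] (0 : N) = 1 ⊗ₜ[B] n by simp)
        (show (1 : B') ⊗ₜ[B] (0 : N) = 0 by simp)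
    have h2 : baseChangeProlAdd D D' c N (1 ⊗ₜ Prol.del D N n) =
        Prol.del D' (B' ⊗[B] N) (1 ⊗ₜ n) :=
      Prod.ext (show (1 : B') ⊗ₜ[B] (0 : N) - D'.der 1 ⊗ₜ[B] n = 0 by simp) rfl
    rw [delS_tmul, map_add, map_add]
    change E.der s ⊗ₜ[B'] baseChangeProlAdd D D' c N (1 ⊗ₜ Prol.incl D N n) +
      s ⊗ₜ[B'] baseChangeProlAdd D D' c N (1 ⊗ₜ Prol.del D N n) = _
    rw [h1, h2]
    rfl

/-- A tensor automorphism of the fibre functor on the category generated by `M ⊗ B'` restricts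
along base change to the category generated by `M`. -/
def TensorAut.descend (c : QDRing.Compat D D') {p : Prop} {M : DMod D}
    (hG : ∀ {N : DMod D}, Gen p M N → Gen p (M.baseChange c) (N.baseChange c))
    (l : TensorAut S p (M.baseChange c)) : TensorAut S p M where
  app N hN := DMod.descend c N (l.app (N.baseChange c) (hG hN))
  natural {N N'} hN hN' f z := by
    obtain ⟨y, rfl⟩ :=
      (TensorProduct.AlgebraTensorModule.cancelBaseChange B B' S S N).surjective z
    rw [cancelBaseChange_baseChange c, descend_cancelBaseChange, descend_cancelBaseChange,
      cancelBaseChange_baseChange c, l.natural (hG hN) (hG hN')]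
  app_unit z := by
    obtain ⟨y, rfl⟩ :=
      (TensorProduct.AlgebraTensorModule.cancelBaseChange B B' S S (DMod.unit D)).surjective z
    rw [descend_cancelBaseChange]
    -- Naturality along B' ⊗ B ≅ B' moves the claim to the unit object over B', where `l` is the
    -- identity.
    refine congrArg _ ((baseChange_bijective (S := S) (baseChangeUnit_bijective c)).1 ?_)
    rw [← l.natural (hG .unit) .unit, l.app_unit]
  app_tensor {N N'} hN hN' z := by
    obtain ⟨y, rfl⟩ :=
      (TensorProduct.AlgebraTensorModule.cancelBaseChange B B' S S (N.tensor N')).surjective z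
    rw [descend_cancelBaseChange, distribBaseChange_cancelBaseChange c,
      distribBaseChange_cancelBaseChange c,
      -- Naturality along `baseChangeTensor` replaces the base change of N ⊗ N' by the tensor
      -- product of base changes, where `l.app_tensor` applies.
      ← l.natural (hG (.tensor hN hN')) (.tensor (hG hN) (hG hN'))]
    refine (congrArg _ (l.app_tensor (hG hN) (hG hN') _)).trans ?_
    rw [← LinearMap.comp_apply, ← LinearMap.comp_apply, ← TensorProduct.map_comp,
      ← TensorProduct.map_comp]
    congr 2 <;> exact LinearMap.ext fun y => (descend_cancelBaseChange c _ _ y).symm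

/-- Transport along the fibre identification and the prolongation isomorphism turns the claim into
`hl` at N ⊗ B'; naturality of `l` along that isomorphism lets it pass through. -/
theorem TensorAut.descend_delS (c : QDRing.Compat D D') {M : DMod D}
    (hG : ∀ {N : DMod D}, Gen True M N → Gen True (M.baseChange c) (N.baseChange c))
    (l : TensorAut S True (M.baseChange c)) (E : D'.DAlg S)
    (hl : ∀ (N : DMod D') (hN : Gen True (M.baseChange c) N) (z : S ⊗[B'] N),
      l.app N.prolong (.prolong trivial hN) (delS E N z) = delS E N (l.app N hN z))
    (N : DMod D) (hN : Gen True M N) (z : S ⊗[B] N) :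
    (l.descend c hG).app N.prolong (.prolong trivial hN) (delS (E.restrict c) N z) =
      delS (E.restrict c) N ((l.descend c hG).app N hN z) := by
  apply (TensorProduct.AlgebraTensorModule.cancelBaseChange B B' S S N.prolong).symm.injective
  apply (baseChange_bijective (S := S) (baseChangeProlong_bijective c N)).1
  rw [baseChangeProlong_delS]
  simp only [TensorAut.descend, DMod.descend, LinearEquiv.trans_apply,
    LinearEquiv.symm_apply_apply]
  rw [← l.natural _ (.prolong trivial (hG hN)), baseChangeProlong_delS, hl]

end Descent

end BaseChange

/-! ### Reduction modulo a prime of constants -/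

section Red

variable {R R' B : Type u} [CommRing R] [CommRing R'] [CommRing B] [Algebra R R'] [Algebra R B]

/-- `Red` is a definition hiding the tensor product, so the induction principle is restated for it.
-/
theorem Red.induction_on {motive : QDRing.Red R R' B → Prop} (z : QDRing.Red R R' B)
    (zero : motive 0) (tmul : ∀ (r : R') (b : B), motive (r ⊗ₜ[R] b : R' ⊗[R] B))
    (add : ∀ x y, motive x → motive y → motive (x + y)) : motive z :=
  TensorProduct.induction_on (motive := motive) z zero tmul add

theorem Red.smul_tmul (b : B) (r : R') (x : B) :
    b • (show QDRing.Red R R' B from (r ⊗ₜ[R] x : R' ⊗[R] B)) = (r ⊗ₜ[R] (b * x) : R' ⊗[R] B) := by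
  change (1 ⊗ₜ[R] b : R' ⊗[R] B) * (r ⊗ₜ[R] x) = _
  rw [Algebra.TensorProduct.tmul_mul_tmul, one_mul]

variable (R R' B) in
/-- `B ⊗_R R'` as a `B`-module. -/
def redComm : QDRing.Red R R' B ≃ₗ[B] B ⊗[R] R' where
  __ : QDRing.Red R R' B ≃+ B ⊗[R] R' := (TensorProduct.comm R R' B).toAddEquiv
  map_smul' b z := by
    let e : QDRing.Red R R' B ≃+ B ⊗[R] R' := (TensorProduct.comm R R' B).toAddEquiv
    change e (b • z) = b • e z
    induction z using Red.induction_on with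
    | zero => rw [smul_zero, map_zero, smul_zero]
    | add x y hx hy => rw [smul_add, map_add, map_add, smul_add, hx, hy]
    | tmul r x =>
      refine (congrArg e (Red.smul_tmul b r x)).trans ?_
      rfl

/-- The identification `(B ⊗_R R') ⊗_B W = W ⊗_R R'`. -/
def redCancel (R' : Type u) [CommRing R'] [Algebra R R'] (W : Type u) [AddCommGroup W] [Module B W]
    [Module R W] [IsScalarTower R B W] : QDRing.Red R R' B ⊗[B] W ≃ₗ[B] W ⊗[R] R' :=
  TensorProduct.comm B (QDRing.Red R R' B) W ≪≫ₗ
    TensorProduct.congr (.refl B W) (redComm R R' B) ≪≫ₗ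
    TensorProduct.AlgebraTensorModule.cancelBaseChange R B B W R'

/-- Naturality of `redCancel`: base change of a B-linear map over B is its base change over the
constants R. -/
theorem redCancel_baseChange {W N : Type u} [AddCommGroup W] [Module B W]
    [Module R W] [IsScalarTower R B W] [AddCommGroup N] [Module B N] [Module R N]
    [IsScalarTower R B N] (f : W →ₗ[B] N) (z : QDRing.Red R R' B ⊗[B] W) :
    redCancel R' N (f.baseChange (QDRing.Red R R' B) z) =
      (f.restrictScalars R).rTensor R' (redCancel R' W z) := by
  induction z with
  | zero => simp only [map_zero]
  | add x y hx hy => simp only [map_add, hx, hy]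
  | tmul b w =>
    induction b using Red.induction_on with
    | zero => simp only [TensorProduct.zero_tmul, map_zero]
    | add x y hx hy => simp only [TensorProduct.add_tmul, map_add, hx, hy]
    | tmul r x =>
      change (x • f w) ⊗ₜ[R] r = f (x • w) ⊗ₜ[R] r
      rw [map_smul]

/-- Reduction is − ⊗_R R' on underlying modules, and R-flatness of the cokernel Q gives Tor₁(Q, R')
= 0, so the sequence stays exact on the left. Flatness over B is not needed. -/
theorem injective_baseChange_red {W N Q : Type u} [AddCommGroup W] [Module B W] [AddCommGroup N]
    [Module B N] [AddCommGroup Q] [Module B Q] {f : W →ₗ[B] N} {g : N →ₗ[B] Q}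
    (hf : Function.Injective f) (hfg : Function.Exact f g) (hg : Function.Surjective g)
    (hQ : @Module.Flat R Q _ _ (Module.compHom Q (algebraMap R B))) :
    Function.Injective (f.baseChange (QDRing.Red R R' B)) := by
  let : Module R W := Module.compHom _ (algebraMap R B)
  let : Module R N := Module.compHom _ (algebraMap R B)
  let : Module R Q := Module.compHom _ (algebraMap R B)
  have : IsScalarTower R B W := .of_algebraMap_smul fun _ _ => rfl
  have : IsScalarTower R B N := .of_algebraMap_smul fun _ _ => rfl
  have : IsScalarTower R B Q := .of_algebraMap_smul fun _ _ => rfl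
  have h : Function.Injective ((f.restrictScalars R).rTensor R') := by
    rw [← LinearMap.lTensor_inj_iff_rTensor_inj]
    exact LinearMap.lTensor_injective_of_exact_of_flat (g.restrictScalars R) hg
      (f.restrictScalars R) hf hfg R'
  refine Function.Injective.of_comp (f := redCancel R' N) ?_
  have : redCancel R' N ∘ f.baseChange (QDRing.Red R R' B) =
      (f.restrictScalars R).rTensor R' ∘ redCancel R' W :=
    funext fun z => redCancel_baseChange f z
  rw [this]
  exact h.comp (redCancel R' W).injective

/-- Reduction modulo a prime of constants maps the category generated by `M` to the category
generated by the reduction of `M`. -/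
theorem Gen.red (hR' : IsField R') {D : QDRing R B} {p : Prop} {M N : DMod D} (hN : Gen p M N) :
    Gen p (M.baseChange (D.red_compat R')) (N.baseChange (D.red_compat R')) :=
  hN.baseChange _ fun f hf hf' =>
    ⟨injective_baseChange_red hf (LinearMap.exact_map_mkQ_range f.toLin)
      (Submodule.mkQ_surjective _) hf',
      Hom.flatCoker_of_isField hR' _⟩

/-! ### Inclusions of the groups of points -/

section Points

variable {S : Type w} [CommRing S] [Algebra B S] [Algebra (QDRing.Red R R' B) S]
  [IsScalarTower B (QDRing.Red R R' B) S]

/-- The generic Galois group of a reduction is contained in the reduction of the generic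
Galois group. -/
theorem descend_mem_Gal (hR' : IsField R') {D : QDRing R B} (M : DMod D)
    {g : (S ⊗[QDRing.Red R R' B] (M.baseChange (D.red_compat R'))) ≃ₗ[S]
      (S ⊗[QDRing.Red R R' B] (M.baseChange (D.red_compat R')))}
    (hg : g ∈ Gal S (M.baseChange (D.red_compat R'))) :
    descend (D.red_compat R') M g ∈ Gal S M := by
  obtain ⟨l, rfl⟩ := hg
  -- `rfl` suffices: the component at M is by definition the descent of the component of `l` at the
  -- reduction, and membership proofs in `Gen` are irrelevant.
  exact ⟨l.descend (D.red_compat R') (fun hN => hN.red hR'), rfl⟩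

/-- The parametrized generic Galois group of a reduction is contained in the reduction of the
parametrized generic Galois group. -/
theorem descend_mem_GalDer (hR' : IsField R') {D : QDRing R B} (M : DMod D)
    (E : (D.red R').DAlg S)
    {g : (S ⊗[QDRing.Red R R' B] (M.baseChange (D.red_compat R'))) ≃ₗ[S]
      (S ⊗[QDRing.Red R R' B] (M.baseChange (D.red_compat R')))}
    (hg : g ∈ GalDer E (M.baseChange (D.red_compat R'))) :
    descend (D.red_compat R') M g ∈ GalDer (E.restrict (D.red_compat R')) M := by
  obtain ⟨l, rfl, hl⟩ := hg
  exact ⟨l.descend (D.red_compat R') (fun hN => hN.red hR'), rfl,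
    l.descend_delS (D.red_compat R') (fun hN => hN.red hR') E hl⟩

end Points

end Red
end DMod

/-! ### The residue field and the theorem -/

/-- As the integral closure of k[q], O_K has dimension at most one, so its nonzero primes are
maximal. -/
theorem QSpec.isField_resField {k K : Type u} [Field k] [Field K] [Algebra k[X] K]
    (v : IsDedekindDomain.HeightOneSpectrum (FunctionField.ringOfIntegers k K)) :
    IsField (QSpec.resField v) := by
  have : Ring.DimensionLEOne (FunctionField.ringOfIntegers k K) :=
    inferInstanceAs (Ring.DimensionLEOne (integralClosure k[X] K))
  exact (Ideal.Quotient.maximal_ideal_iff_isField_quotient _).1 (v.isPrime.isMaximal v.ne_bot)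

end

theorem mainTheorem7 {k K : Type u} [Field k] [Field K] [Algebra k[X] K] [Algebra (RatFunc k) K]
    [IsScalarTower k[X] (RatFunc k) K] [FunctionField k K]
    (P : (FunctionField.ringOfIntegers k K)[X]) (hP : P ≠ 0)
    (v : IsDedekindDomain.HeightOneSpectrum (FunctionField.ringOfIntegers k K))
    (hv : QSpec.q k K ∉ v.asIdeal)
    (M : DMod (QSpec.ringA P)) :
    (∀ (S : Type w) [CommRing S] [Algebra (QSpec.A P) S] [Algebra (QSpec.Av P v) S]
        [IsScalarTower (QSpec.A P) (QSpec.Av P v) S],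
      ∀ g ∈ DMod.Gal S (QSpec.spec M v),
        DMod.descend (QSpec.compat P v) M g ∈ DMod.Gal S M) ∧
    (CharZero k →
      ∀ (S : Type w) [CommRing S] [Algebra (QSpec.A P) S] [Algebra (QSpec.Av P v) S]
        [IsScalarTower (QSpec.A P) (QSpec.Av P v) S]
        (E : QDRing.DAlg ((QSpec.ringA P).red (QSpec.resField v)) S),
      ∀ g ∈ DMod.GalDer E (QSpec.spec M v),
        DMod.descend (QSpec.compat P v) M g ∈ DMod.GalDer (E.restrict (QSpec.compat P v)) M) := by
  exact ⟨fun S _ _ _ _ g hg => DMod.descend_mem_Gal (QSpec.isField_resField v) M hg,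
    fun _ S _ _ _ _ E g hg => DMod.descend_mem_GalDer (QSpec.isField_resField v) M E hg⟩
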